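/- **Setting.** Graphs are finite and simple, and $G=(V,E)$ has at least one vertex. A *grid point* is a point of $\mathbb{Z}^2\subset\mathbb{R}^2$. A *straight-line path* $(p_1,\dots,p_k)$ (with $k\ge 2$), or *cycle*, is a plane (non-self-intersecting) path or cycle whose vertices are grid points and whose edges are line segments; it is *axis-parallel* if every edge is parallel to an axis. A *polyline grid drawing* $d$ of $G$ maps the vertices of $G$ injectively to grid points and each edge $\{u,v\}$ to a straight-line path between $d(u)$ and $d(v)$. A *frame* is an axis-parallel cycle. A point not on a frame $f$ is *strictly inside* (*strictly outside*) $f$ if it lies in the bounded (unbounded) component of $\mathbb{R}^2\setminus f$; *inside* means on $f$ or strictly inside $f$. For a frame $f$, $f^{\min}$ is the frame with the same point set and the fewest vertices. A *cutter* of $f$ is an axis-parallel path $c=(c_1,\dots,c_t)$ inside $f$ whose set of common points with $f$ is $\{c_1,c_t\}$. Joining $c$ with each of the two arcs of $f$ between $c_1$ and $c_t$, and applying $(\cdot)^{\min}$, gives two frames $f_1(c)$, $f_2(c)$, where $f_1(c)$ is the one through the lexicographically smallest grid point of $f$ other than $c_1,c_t$. A frame $f$ *separates* an edge $\{u,v\}$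 if one of $d(u),d(v)$ is strictly inside $f$ and the other is strictly outside $f$. $\mathsf{VerAsso}(f)$ is the set of vertices of $G$ drawn on $f$ together with the endpoints of the edges separated by $f$. $\mathsf{VerAsso}(c,f)$ is the set of vertices drawn on $c$ together with the endpoints of the edges $\{u,v\}$ such that $u,v$ are drawn inside $f$ and $f_1(c)$ or $f_2(c)$ separates $\{u,v\}$. For a path, cycle or segment $P$, $\mathsf{Enr}(P)$ is the set of intersection points of each edge $e$ of $P$ with all line segments between two grid points that are not parallel to $e$. For an edge $e=\{u,v\}$ and $p\in\mathsf{Enr}(d(e))\cap\mathsf{Enr}(f)$, the pair $(p,e)$ is a *turning point* in $f$ if either $p\in\{d(u),d(v)\}$ and $p$ lies on $f$; or $p\notin\{d(u),d(v)\}$ and, where $(p_i,\dots,p_j)$ is the smallest subpath of $d(e)$ containing $p$ with $p\notin\{p_i,p_j\}$, for some $q\in\{p_i,p_j\}$ and some $\varepsilon>0$ the initial piece $s$ of length $\varepsilon$ of the segment from $p$ to $q$ satisfies $\mathsf{Enr}(s)\cap\mathsf{Enr}(f)=\{p\}$. The *cost* of $f$ in $d$ is the number of vertices of $f^{\min}$,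 plus the number of vertices of $G$ drawn on $f$, plus the number of turning points in $f$. Let $x_{\min},x_{\max},y_{\min},y_{\max}$ be the extreme coordinates of the points $d(u)$, $u\in V$, and let $R_d$ be the boundary of $[x_{\min}-1,x_{\max}+1]\times[y_{\min}-1,y_{\max}+1]$ as a frame with four vertices. A *frame-tree* of $d$ is a pair $(\mathcal{T},\alpha)$ of a finite rooted tree $\mathcal{T}$ and a map $\alpha$ from its nodes to frames such that: the root is mapped to $R_d$; every internal node $v$ has exactly two children $v_1,v_2$, and there is a cutter $c_v$ of $\alpha(v)$ with $\alpha(v_1)=f_1(c_v)$, $\alpha(v_2)=f_2(c_v)$ for $f=\alpha(v)$; a node $v$ is a leaf if and only if no grid point is strictly inside $\alpha(v)$. Its *width* is $\max_v\mathsf{cost}(\alpha(v))$. Given such cutters, put $\beta(v)=\mathsf{VerAsso}(\alpha(v))\cup\mathsf{VerAsso}(c_v,\alpha(v))$ for internal $v$ and $\beta(v)=\mathsf{VerAsso}(\alpha(v))$ for leaves $v$. A *drawn tree decomposition* of $d$ is a triple $(\mathcal{T},\beta,\alpha)$, where $(\mathcal{T},\alpha)$ is a frame-tree of $d$, $\beta$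 is given by these formulas, and $(\mathcal{T},\beta)$ is a tree decomposition of $G$; its width is that of $(\mathcal{T},\alpha)$. The *drawn treewidth* $\mathsf{dtw}(d)$ is the minimum width of a drawn tree decomposition of $d$. **Theorem.** Let $G$ be a graph and $d$ a polyline grid drawing of $G$. For every frame-tree $(\mathcal{T},\alpha)$ of $d$, with $c_v$ and $\beta$ as above: 1. $(\mathcal{T},\beta)$ is a tree decomposition of $G$. 2. $|\beta(v)|\le 2\,(\mathsf{cost}(\alpha(v))+\mathsf{cost}(\alpha(v_1))+\mathsf{cost}(\alpha(v_2)))$ for every internal node $v$ with children $v_1,v_2$. 3. $|\beta(v)|\le 2\,\mathsf{cost}(\alpha(v))$ for every leaf $v$. 4. $\max_v|\beta(v)|-1\le 6\cdot\max_v\mathsf{cost}(\alpha(v))$, that is, the width of $(\mathcal{T},\beta)$ is at most $6$ times the width of $(\mathcal{T},\alpha)$. Consequently, $\mathsf{tw}(G)\le 6\cdot\mathsf{dtw}(d)$. -/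

import Mathlib

namespace DrawnTW

/-! ### Plane geometry on the integer grid -/

/-- Grid points: points of the plane with integer coordinates. -/
abbrev GridPt := ℤ × ℤ

/-- The plane. -/
abbrev Plane := ℝ × ℝ

/-- A grid point as a point of the plane. -/
def GridPt.toPlane (p : GridPt) : Plane := ((p.1 : ℝ), (p.2 : ℝ))

/-- The closed line segment between two grid points. -/
def seg (e : GridPt × GridPt) : Set Plane := segment ℝ e.1.toPlane e.2.toPlane

/-- The edges of the path `(p₁, …, p_k)`: the pairs `(p_i, p_{i+1})`. -/
def pathEdges (L : List GridPt) : List (GridPt × GridPt) := L.zip L.tail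

/-- The edges of the cycle `(p₁, …, p_k, p₁)`: the pairs `(p_i, p_{i+1})` together with
`(p_k, p₁)`. The starting point is listed only once. -/
def cycleEdges (L : List GridPt) : List (GridPt × GridPt) := L.zip (L.rotate 1)

/-- The points of the plane lying on one of the given edges. -/
def edgePoints (E : List (GridPt × GridPt)) : Set Plane := {x | ∃ e ∈ E, x ∈ seg e}

/-- Any two of the given edges meet at most in a common endpoint. -/
def PlaneEdges (E : List (GridPt × GridPt)) : Prop :=
  E.Pairwise fun e e' => ∀ x, x ∈ seg e → x ∈ seg e' →
    (x = e.1.toPlane ∨ x = e.2.toPlane) ∧ (x = e'.1.toPlane ∨ x = e'.2.toPlane)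

/-- The edge is parallel to one of the two axes. -/
def AxisParallel (e : GridPt × GridPt) : Prop := e.1.1 = e.2.1 ∨ e.1.2 = e.2.2

/-- A straight-line path: a plane path with at least two vertices, whose vertices are grid points
and whose edges are line segments. -/
structure StraightLinePath where
  verts : List GridPt
  two_le : 2 ≤ verts.length
  nodup : verts.Nodup
  plane : PlaneEdges (pathEdges verts)

namespace StraightLinePath

variable (P : StraightLinePath)

theorem ne_nil : P.verts ≠ [] := by
  intro h
  have h2 := P.two_le
  simp [h] at h2

/-- The first vertex of the path. -/
def first : GridPt := P.verts.head P.ne_nil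

/-- The last vertex of the path. -/
def last : GridPt := P.verts.getLast P.ne_nil

/-- The points of the plane on the path. -/
def points : Set Plane := edgePoints (pathEdges P.verts)

end StraightLinePath

/-- A frame: an axis-parallel cycle, that is, a plane cycle (with at least three vertices) whose
vertices are grid points and whose edges are axis-parallel line segments. -/
structure Frame where
  verts : List GridPt
  three_le : 3 ≤ verts.length
  nodup : verts.Nodup
  plane : PlaneEdges (cycleEdges verts)
  axis : ∀ e ∈ cycleEdges verts, AxisParallel e

namespace Frame

variable (f : Frame)

/-- The points of the plane on the frame. -/
def points : Set Plane := edgePoints (cycleEdges f.verts)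

/-- `x` is strictly inside `f`: it is not on `f` and lies in a bounded connected component of the
complement of `f`. -/
def StrictlyInside (x : Plane) : Prop :=
  x ∉ f.points ∧ Bornology.IsBounded (connectedComponentIn f.pointsᶜ x)

/-- `x` is strictly outside `f`: it is not on `f` and lies in an unbounded connected component of
the complement of `f`. -/
def StrictlyOutside (x : Plane) : Prop :=
  x ∉ f.points ∧ ¬ Bornology.IsBounded (connectedComponentIn f.pointsᶜ x)

/-- `x` is inside `f`: on `f` or strictly inside `f`. -/
def Inside (x : Plane) : Prop := x ∈ f.points ∨ f.StrictlyInside x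

/-- `f` has the minimum number of vertices among all frames with point set `S`, and its point set
is `S`. -/
def IsMinFor (S : Set Plane) : Prop :=
  f.points = S ∧ ∀ g : Frame, g.points = S → f.verts.length ≤ g.verts.length

/-- The number of vertices of `f^min`, the frame with the fewest vertices that has the same point
set as `f`. -/
noncomputable def minVerts : ℕ :=
  sInf {n | ∃ g : Frame, g.points = f.points ∧ g.verts.length = n}

end Frame

/-! ### Cutters -/

/-- `c` is a cutter of `f`: an axis-parallel path inside `f` that meets `f` exactly in the two
endpoints of `c`. -/
def IsCutter (c : StraightLinePath) (f : Frame) : Prop :=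
  (∀ e ∈ pathEdges c.verts, AxisParallel e) ∧
  (∀ x ∈ c.points, f.Inside x) ∧
  f.points ∩ c.points = {c.first.toPlane, c.last.toPlane}

/-- `f'` is `frame(f, c)`: the frame equal to `f` as a point set, whose vertices are exactly those
of `f` and the two endpoints of `c`. -/
def IsFrameOf (f : Frame) (c : StraightLinePath) (f' : Frame) : Prop :=
  f'.points = f.points ∧ ∀ p, p ∈ f'.verts ↔ p ∈ f.verts ∨ p = c.first ∨ p = c.last

/-- `p` is the smallest grid point, in the lexicographic order, on `f` that is not an endpoint of
`c`. -/
def IsMinGridPoint (f : Frame) (c : StraightLinePath) (p : GridPt) : Prop :=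
  (p.toPlane ∈ f.points ∧ p ≠ c.first ∧ p ≠ c.last) ∧
  ∀ q : GridPt, q.toPlane ∈ f.points ∧ q ≠ c.first ∧ q ≠ c.last →
    p.1 < q.1 ∨ (p.1 = q.1 ∧ p.2 ≤ q.2)

/-- `g₁` and `g₂` are the first and the second frame associated with `f` and the cutter
`c = (c₁, …, c_t)`. Here `frame(f, c)` is traversed from `c₁` through the vertices `A` to `c_t`,
and then through the vertices `B` back to `c₁`. Following `c` and then `B`, respectively `c` and
then `A` backwards, gives two cycles; the first associated frame is the one through the smallest
grid point of `f` that is not an endpoint of `c`. Both are taken with the minimum number of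
vertices. -/
def IsAssoFr (f : Frame) (c : StraightLinePath) (g₁ g₂ : Frame) : Prop :=
  ∃ (f' : Frame) (A B : List GridPt) (p : GridPt),
    IsFrameOf f c f' ∧ f'.verts = c.first :: A ++ c.last :: B ∧ IsMinGridPoint f c p ∧
    ((p.toPlane ∈ edgePoints (cycleEdges (c.verts ++ B)) ∧
        g₁.IsMinFor (edgePoints (cycleEdges (c.verts ++ B))) ∧
        g₂.IsMinFor (edgePoints (cycleEdges (c.verts ++ A.reverse)))) ∨
     (p.toPlane ∈ edgePoints (cycleEdges (c.verts ++ A.reverse)) ∧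
        g₁.IsMinFor (edgePoints (cycleEdges (c.verts ++ A.reverse))) ∧
        g₂.IsMinFor (edgePoints (cycleEdges (c.verts ++ B)))))

/-! ### Enriched grid points -/

/-- The intersection points of the segment `ab` with all line segments between two grid points that
are not parallel to `ab`. -/
def enrichedSegment (a b : Plane) : Set Plane :=
  {x | x ∈ segment ℝ a b ∧ ∃ g h : GridPt, x ∈ seg (g, h) ∧
    (b.1 - a.1) * ((h.2 : ℝ) - (g.2 : ℝ)) - (b.2 - a.2) * ((h.1 : ℝ) - (g.1 : ℝ)) ≠ 0}

/-- The enriched grid points of a path or cycle with the given edges. -/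
def enriched (E : List (GridPt × GridPt)) : Set Plane :=
  {x | ∃ e ∈ E, x ∈ enrichedSegment e.1.toPlane e.2.toPlane}

/-! ### Polyline grid drawings -/

/-- A polyline grid drawing of `G`: distinct vertices are mapped to distinct grid points, and every
edge is mapped to a straight-line path between the images of its endpoints. -/
structure PolylineGridDrawing {V : Type*} (G : SimpleGraph V) where
  vert : V → GridPt
  vert_injective : Function.Injective vert
  edge : G.edgeSet → StraightLinePath
  edge_ends : ∀ e : G.edgeSet, s((edge e).first, (edge e).last) = Sym2.map vert (e : Sym2 V)

/-- `(p_i, …, p_j)`, with `i < j` and `p ∉ {p_i, p_j}`, is a subpath of `P` that contains `p`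
(indices start at `0`). -/
def SubpathAround (P : StraightLinePath) (p : Plane) (i j : Fin P.verts.length) : Prop :=
  i < j ∧ p ≠ (P.verts.get i).toPlane ∧ p ≠ (P.verts.get j).toPlane ∧
  p ∈ edgePoints (pathEdges ((P.verts.take (j + 1)).drop i))

/-- For some `ε > 0`, the initial piece of the segment `pq` of length `ε` has no enriched grid
point in common with `f` except `p`, and `p` is a common one. The piece is described by the
fraction `t = ε / |pq|`. -/
def LocallyLeaves (f : Frame) (p q : Plane) : Prop :=
  ∃ t : ℝ, 0 < t ∧ t ≤ 1 ∧
    enrichedSegment p (AffineMap.lineMap p q t) ∩ enriched (cycleEdges f.verts) = {p}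

namespace PolylineGridDrawing

variable {V : Type*} {G : SimpleGraph V} (d : PolylineGridDrawing G)

/-- The point of the plane at which `u` is drawn. -/
def pos (u : V) : Plane := (d.vert u).toPlane

/-- `(p, e)` is a turning point in `f`: either `p` is the position of an endpoint of `e` and lies
on `f`, or `p` is another common enriched grid point of `f` and of the drawing `(p_1, …, p_k)` of
`e`, and for the smallest subpath `(p_i, …, p_j)` through `p` with `p ∉ {p_i, p_j}`, the drawing
leaves `f` at `p` towards `p_i` or towards `p_j`. -/
def IsTurningPoint (f : Frame) (e : G.edgeSet) (p : Plane) : Prop :=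
  ((∃ u ∈ (e : Sym2 V), p = d.pos u) ∧ p ∈ f.points) ∨
  ((∀ u ∈ (e : Sym2 V), p ≠ d.pos u) ∧
    p ∈ enriched (pathEdges (d.edge e).verts) ∩ enriched (cycleEdges f.verts) ∧
    ∃ i j : Fin (d.edge e).verts.length,
      SubpathAround (d.edge e) p i j ∧
      (∀ i' j', SubpathAround (d.edge e) p i' j' → (j : ℕ) - i ≤ (j' : ℕ) - i') ∧
      (LocallyLeaves f p ((d.edge e).verts.get i).toPlane ∨
        LocallyLeaves f p ((d.edge e).verts.get j).toPlane))

/-- The number of turning points in `f`. -/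
noncomputable def turnPoints (f : Frame) : ℕ∞ :=
  {x : Plane × G.edgeSet |
    x.1 ∈ enriched (pathEdges (d.edge x.2).verts) ∩ enriched (cycleEdges f.verts) ∧
    d.IsTurningPoint f x.2 x.1}.encard

/-- The cost of a frame: the number of vertices of `f^min`, plus the number of vertices of `G`
drawn on `f`, plus the number of turning points in `f`. -/
noncomputable def cost (f : Frame) : ℕ∞ :=
  (f.minVerts : ℕ∞) + {u : V | d.pos u ∈ f.points}.encard + d.turnPoints f

/-- One of `u`, `v` is drawn strictly inside `f` and the other one strictly outside `f`. -/
def Separates (f : Frame) (u v : V) : Prop :=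
  (f.StrictlyInside (d.pos u) ∧ f.StrictlyOutside (d.pos v)) ∨
  (f.StrictlyInside (d.pos v) ∧ f.StrictlyOutside (d.pos u))

/-- The vertices associated with the frame `f`: those drawn on `f` and the endpoints of the edges
separated by `f`. -/
def verAsso (f : Frame) : Set V :=
  {u | d.pos u ∈ f.points} ∪ {u | ∃ v, G.Adj u v ∧ d.Separates f u v}

/-- The vertices associated with the cutter `c` of `f`, where `f₁`, `f₂` are the two frames
associated with `f` and `c`: those drawn on `c`, and the endpoints of the edges with both endpoints
drawn inside `f` that are separated by `f₁` or by `f₂`. -/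
def verAssoCutter (c : StraightLinePath) (f f₁ f₂ : Frame) : Set V :=
  {u | d.pos u ∈ c.points} ∪
  {u | ∃ v, G.Adj u v ∧ f.Inside (d.pos u) ∧ f.Inside (d.pos v) ∧
    (d.Separates f₁ u v ∨ d.Separates f₂ u v)}

/-- The vertices of the rectangular of the drawing: the smallest rectangle (with grid points as
corners) with all vertices of `G` drawn strictly inside. -/
noncomputable def rectangularVerts : List GridPt :=
  [((⨅ u, (d.vert u).1) - 1, (⨅ u, (d.vert u).2) - 1),
   ((⨅ u, (d.vert u).1) - 1, (⨆ u, (d.vert u).2) + 1),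
   ((⨆ u, (d.vert u).1) + 1, (⨆ u, (d.vert u).2) + 1),
   ((⨆ u, (d.vert u).1) + 1, (⨅ u, (d.vert u).2) - 1)]

end PolylineGridDrawing

/-! ### Tree decompositions and treewidth -/

/-- `(T, β)` is a tree decomposition of `G`. -/
def IsTreeDecomposition {V N : Type*} (G : SimpleGraph V) (T : SimpleGraph N) (β : N → Set V) :
    Prop :=
  T.IsTree ∧
  (∀ u : V, (T.induce {x | u ∈ β x}).Connected) ∧
  (∀ u v : V, G.Adj u v → ∃ x, u ∈ β x ∧ v ∈ β x)

/-- The maximum size of a bag, minus one. -/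
noncomputable def bagWidth {V N : Type*} (β : N → Set V) : ℕ∞ := (⨆ x, (β x).encard) - 1

/-- The treewidth of `G`: the minimum width of a tree decomposition (over a finite tree). -/
noncomputable def treewidth {V : Type*} (G : SimpleGraph V) : ℕ∞ :=
  ⨅ (m : ℕ) (T : SimpleGraph (Fin m)) (β : Fin m → Set V) (_ : IsTreeDecomposition G T β),
    bagWidth β

/-! ### Frame-trees and drawn tree decompositions -/

/-- The children of `v` in the tree `T` rooted at `r`. -/
def childSet {N : Type*} (T : SimpleGraph N) (r v : N) : Set N :=
  {w | T.Adj v w ∧ T.dist r w = T.dist r v + 1}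

/-- `v₁` and `v₂` are the two children of `v` in the tree `T` rooted at `r`. -/
def AreChildren {N : Type*} (T : SimpleGraph N) (r v v₁ v₂ : N) : Prop :=
  v₁ ≠ v₂ ∧ childSet T r v = {v₁, v₂}

/-- A frame-tree of `d` on the node set `N`, together with the cutters associated with its internal
nodes (the cutter at a leaf is irrelevant). -/
structure FrameTree {V : Type*} {G : SimpleGraph V} (d : PolylineGridDrawing G) (N : Type*) where
  tree : SimpleGraph N
  isTree : tree.IsTree
  root : N
  frame : N → Frame
  cutter : N → StraightLinePath
  frame_root : (frame root).verts = d.rectangularVerts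
  internal : ∀ v, childSet tree root v ≠ ∅ → IsCutter (cutter v) (frame v) ∧
    ∃ v₁ v₂, AreChildren tree root v v₁ v₂ ∧
      IsAssoFr (frame v) (cutter v) (frame v₁) (frame v₂)
  leaf_iff : ∀ v, childSet tree root v = ∅ ↔
    ¬ ∃ p : GridPt, (frame v).StrictlyInside p.toPlane

namespace FrameTree

variable {V N : Type*} {G : SimpleGraph V} {d : PolylineGridDrawing G} (t : FrameTree d N)

/-- The node `v` has no children. -/
def IsLeaf (v : N) : Prop := childSet t.tree t.root v = ∅

/-- The bag of `v`: the vertices associated with the frame of `v` and, if `v` is internal, also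
those associated with the cutter of `v`. -/
def bag (v : N) : Set V :=
  d.verAsso (t.frame v) ∪
  {u | ∃ v₁ v₂, AreChildren t.tree t.root v v₁ v₂ ∧
    u ∈ d.verAssoCutter (t.cutter v) (t.frame v) (t.frame v₁) (t.frame v₂)}

/-- The maximum cost of a frame of the frame-tree. -/
noncomputable def width : ℕ∞ := ⨆ v, d.cost (t.frame v)

end FrameTree

/-- A drawn tree decomposition of `d`: a frame-tree whose bags form a tree decomposition of `G`. -/
structure DrawnTreeDecomposition {V : Type*} {G : SimpleGraph V} (d : PolylineGridDrawing G)
    (N : Type*) extends FrameTree d N where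
  β : N → Set V
  isTreeDecomposition : IsTreeDecomposition G tree β
  β_eq : ∀ v, β v = toFrameTree.bag v

/-- The drawn treewidth of `d`: the minimum width of a drawn tree decomposition of `d` (over a
finite tree). -/
noncomputable def drawnTreewidth {V : Type*} {G : SimpleGraph V} (d : PolylineGridDrawing G) :
    ℕ∞ :=
  ⨅ (m : ℕ) (D : DrawnTreeDecomposition d (Fin m)), D.toFrameTree.width

end DrawnTW

namespace DrawnTW

/-! ### Edges of paths and cycles -/

/-! The geometric input is a Jordan-type statement: a cutter divides the strict interior of a frame
into the two disjoint strict interiors of the associated frames and points on the cutter. It is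
obtained from counting modulo 2 on the unit grid. A frame splits into unit edges that form an
even-degree set with no smaller nonempty even-degree subset (`Frame.gridCurve`). Evenness yields a
finitely supported function on the unit cells that jumps exactly across these edges
(`GridCurve.exists_isPotential`), and minimality shows that it is 1 exactly on the bounded
components of the complement (`GridCurve.isBounded_component_iff`). Off grid points the frame is the
symmetric difference of its two parts, so the potentials add, and `IsTheta.left_or_right` and
`IsTheta.not_left_and_right` follow.

Consequently every vertex `u` has exactly one home: the node with `u` strictly inside its frame and
on its cutter. The nodes whose bags contain `u` are connected because each of them is joined to the
home within this set (`FrameTree.reaches_of_mem_bag`). An edge of the graph is caught by descending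
from the root, where both ends are strictly inside, until an end is cut or the ends are separated
(`FrameTree.exists_bag`).

For the sizes, the drawing of a separated edge must meet the frame, and its first contact on some
segment is a turning point (`PolylineGridDrawing.exists_isTurningPoint`). So separated edges number
at most the turning points, each contributing two vertices, and `verAsso` has at most twice the cost
many elements. What a cutter contributes to a bag is already associated with the two child frames,
so at most three frames are charged per bag. -/

theorem mem_pathEdges {L : List GridPt} {e : GridPt × GridPt} :
    e ∈ pathEdges L ↔ ∃ i, ∃ h : i + 1 < L.length, e = (L[i], L[i + 1]) := by
  unfold pathEdges
  rw [List.mem_iff_getElem]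
  constructor
  · rintro ⟨i, h, rfl⟩
    simp only [List.length_zip, List.length_tail, lt_inf_iff] at h
    exact ⟨i, by omega, by simp⟩
  · rintro ⟨i, h, rfl⟩
    exact ⟨i, by simp; omega, by simp⟩

theorem mem_cycleEdges {L : List GridPt} {e : GridPt × GridPt} :
    e ∈ cycleEdges L ↔ ∃ i, ∃ h : i < L.length,
      e = (L[i], L[(i + 1) % L.length]'(Nat.mod_lt _ (by omega))) := by
  unfold cycleEdges
  rw [List.mem_iff_getElem]
  constructor
  · rintro ⟨i, h, rfl⟩
    simp only [List.length_zip, List.length_rotate, lt_inf_iff] at h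
    exact ⟨i, by omega, by simp [List.getElem_rotate]⟩
  · rintro ⟨i, h, rfl⟩
    exact ⟨i, by simpa using h, by simp [List.getElem_rotate]⟩

theorem pathEdges_cons_cons (a b : GridPt) (L : List GridPt) :
    pathEdges (a :: b :: L) = (a, b) :: pathEdges (b :: L) := rfl

theorem pathEdges_append (L : List GridPt) (a : GridPt) (M : List GridPt) :
    pathEdges (L ++ a :: M) = pathEdges (L ++ [a]) ++ pathEdges (a :: M) := by
  induction L with
  | nil => simp [pathEdges]
  | cons b L ih =>
    cases L with
    | nil => simp [pathEdges]
    | cons c L => simpa [pathEdges_cons_cons] using ih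

/-- Repeating the starting point turns a cycle into a path, so that `pathEdges_append` can split it
into arcs. -/
theorem cycleEdges_cons (a : GridPt) (L : List GridPt) :
    cycleEdges (a :: L) = pathEdges (a :: (L ++ [a])) := by
  simp only [cycleEdges, pathEdges, List.rotate_cons_succ, List.rotate_zero, List.tail_cons]
  have h := List.zip_append (l₁ := a :: L) (l₂ := L ++ [a]) (r₁ := [a]) (r₂ := []) (by simp)
  simpa using h.symm

theorem edgePoints_append (E F : List (GridPt × GridPt)) :
    edgePoints (E ++ F) = edgePoints E ∪ edgePoints F := by
  ext x; simp [edgePoints, or_and_right, exists_or]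

theorem seg_swap (a b : GridPt) : seg (a, b) = seg (b, a) := segment_symm _ _ _

theorem edgePoints_pathEdges_reverse (L : List GridPt) :
    edgePoints (pathEdges L.reverse) = edgePoints (pathEdges L) := by
  induction L with
  | nil => rfl
  | cons a L ih =>
    cases L with
    | nil => rfl
    | cons b L =>
      have h := pathEdges_append L.reverse b [a]
      rw [List.reverse_cons, List.reverse_cons, List.append_assoc, List.singleton_append, h,
        edgePoints_append, pathEdges_cons_cons, ← List.reverse_cons, ih]
      ext x
      simp [edgePoints, pathEdges, seg_swap a b, or_comm]

theorem isCompact_seg (e : GridPt × GridPt) : IsCompact (seg e) := by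
  unfold seg
  rw [segment_eq_image_lineMap]
  exact isCompact_Icc.image (AffineMap.lineMap_continuous)

theorem isCompact_edgePoints (E : List (GridPt × GridPt)) : IsCompact (edgePoints E) := by
  have : edgePoints E = ⋃ e ∈ {e | e ∈ E}, seg e := by ext x; simp [edgePoints]
  rw [this]
  exact (List.finite_toSet E).isCompact_biUnion fun e _ => isCompact_seg e

theorem Frame.isCompact_points (f : Frame) : IsCompact f.points := isCompact_edgePoints _

theorem toPlane_injective : Function.Injective GridPt.toPlane := by
  rintro ⟨a, b⟩ ⟨c, d⟩ h
  simpa [GridPt.toPlane] using h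

theorem PlaneEdges.endpoints {E : List (GridPt × GridPt)} (h : PlaneEdges E)
    {e e' : GridPt × GridPt} (he : e ∈ E) (he' : e' ∈ E) (hne : e ≠ e') {p : GridPt}
    (hp : p.toPlane ∈ seg e) (hp' : p.toPlane ∈ seg e') :
    (p = e.1 ∨ p = e.2) ∧ (p = e'.1 ∨ p = e'.2) := by
  have : Std.Symm fun e e' : GridPt × GridPt => ∀ x, x ∈ seg e → x ∈ seg e' →
      (x = e.1.toPlane ∨ x = e.2.toPlane) ∧ (x = e'.1.toPlane ∨ x = e'.2.toPlane) :=
    ⟨fun a b hab x hx hx' => (hab x hx' hx).symm⟩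
  have := List.Pairwise.forall h he he' hne _ hp hp'
  simpa only [toPlane_injective.eq_iff] using this

/-! ### The cyclic list of edges of a frame -/

namespace Frame

variable (f : Frame)

theorem exists_next {e} (he : e ∈ cycleEdges f.verts) : ∃ e' ∈ cycleEdges f.verts, e'.1 = e.2 := by
  obtain ⟨i, h, rfl⟩ := mem_cycleEdges.1 he
  exact ⟨_, mem_cycleEdges.2 ⟨_, Nat.mod_lt (i + 1) (by omega), rfl⟩, rfl⟩

theorem exists_prev {e} (he : e ∈ cycleEdges f.verts) : ∃ e' ∈ cycleEdges f.verts, e'.2 = e.1 := by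
  obtain ⟨i, h, rfl⟩ := mem_cycleEdges.1 he
  have := f.three_le
  rcases Nat.eq_zero_or_pos i with rfl | hi
  · refine ⟨_, mem_cycleEdges.2 ⟨f.verts.length - 1, by omega, rfl⟩, ?_⟩
    have : (f.verts.length - 1 + 1) % f.verts.length = 0 := by
      rw [Nat.sub_add_cancel (by omega), Nat.mod_self]
    simp [this]
  · refine ⟨_, mem_cycleEdges.2 ⟨i - 1, by omega, rfl⟩, ?_⟩
    have : (i - 1 + 1) % f.verts.length = i := by
      rw [Nat.sub_add_cancel (by omega), Nat.mod_eq_of_lt h]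
    simp [this]

theorem eq_of_fst_eq {e e'} (he : e ∈ cycleEdges f.verts) (he' : e' ∈ cycleEdges f.verts)
    (h : e.1 = e'.1) : e = e' := by
  obtain ⟨i, hi, rfl⟩ := mem_cycleEdges.1 he
  obtain ⟨j, hj, rfl⟩ := mem_cycleEdges.1 he'
  have : i = j := (f.nodup.getElem_inj_iff).1 h
  subst this; rfl

theorem succ_mod (n i : ℕ) (h : i < n) : (i + 1) % n = if i + 1 = n then 0 else i + 1 := by
  split_ifs with hn
  · simp [hn]
  · exact Nat.mod_eq_of_lt (by omega)

theorem eq_of_snd_eq {e e'} (he : e ∈ cycleEdges f.verts) (he' : e' ∈ cycleEdges f.verts)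
    (h : e.2 = e'.2) : e = e' := by
  obtain ⟨i, hi, rfl⟩ := mem_cycleEdges.1 he
  obtain ⟨j, hj, rfl⟩ := mem_cycleEdges.1 he'
  have h2 : (i + 1) % f.verts.length = (j + 1) % f.verts.length := (f.nodup.getElem_inj_iff).1 h
  rw [succ_mod _ _ hi, succ_mod _ _ hj] at h2
  have : i = j := by split_ifs at h2 <;> omega
  subst this; rfl

theorem fst_ne_snd {e} (he : e ∈ cycleEdges f.verts) : e.1 ≠ e.2 := by
  obtain ⟨i, hi, rfl⟩ := mem_cycleEdges.1 he
  have := f.three_le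
  intro h
  have h2 : i = (i + 1) % f.verts.length := (f.nodup.getElem_inj_iff).1 h
  rw [succ_mod _ _ hi] at h2
  split_ifs at h2 <;> omega

/-- This is where at least three vertices are needed: a cycle on two vertices would run back along
its only segment. -/
theorem swap_notMem {e} (he : e ∈ cycleEdges f.verts) : (e.2, e.1) ∉ cycleEdges f.verts := by
  intro he'
  obtain ⟨i, hi, rfl⟩ := mem_cycleEdges.1 he
  obtain ⟨j, hj, h⟩ := mem_cycleEdges.1 he'
  have := f.three_le
  obtain ⟨h1, h2⟩ := Prod.mk_inj.1 h
  have h1 := (f.nodup.getElem_inj_iff).1 h1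
  have h2 := (f.nodup.getElem_inj_iff).1 h2
  rw [succ_mod _ _ hi] at h1
  rw [succ_mod _ _ hj] at h2
  split_ifs at h1 h2 <;> omega

/-- A property of edges of a frame that passes to the next edge holds for all edges as soon as it
holds for one. -/
theorem edge_induction {Q : GridPt × GridPt → Prop}
    (hQ : ∀ e ∈ cycleEdges f.verts, ∀ e' ∈ cycleEdges f.verts, e'.1 = e.2 → Q e → Q e')
    {e e'} (he : e ∈ cycleEdges f.verts) (he' : e' ∈ cycleEdges f.verts) (h : Q e) : Q e' := by
  have h3 := f.three_le
  have hpos : 0 < f.verts.length := by omega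
  obtain ⟨i, hi, rfl⟩ := mem_cycleEdges.1 he
  obtain ⟨j, hj, rfl⟩ := mem_cycleEdges.1 he'
  have key : ∀ m, Q (f.verts[(i + m) % f.verts.length]'(Nat.mod_lt _ hpos),
      f.verts[((i + m) % f.verts.length + 1) % f.verts.length]'(Nat.mod_lt _ hpos)) := by
    intro m
    induction m with
    | zero => simpa [Nat.mod_eq_of_lt hi] using h
    | succ m ih =>
      refine hQ _ (mem_cycleEdges.2 ⟨_, Nat.mod_lt _ hpos, rfl⟩) _
        (mem_cycleEdges.2 ⟨_, Nat.mod_lt _ hpos, rfl⟩) ?_ ih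
      simp only [Nat.mod_add_mod, add_assoc]
  -- Adding the length before subtracting `i` avoids truncation, and the full turn disappears modulo
  -- the length.
  have := key (j + f.verts.length - i)
  have e : (i + (j + f.verts.length - i)) % f.verts.length = j := by
    rw [show i + (j + f.verts.length - i) = j + f.verts.length by omega, Nat.add_mod_right,
      Nat.mod_eq_of_lt hj]
  simpa only [e] using this

end Frame

/-! ### Unit steps along a frame -/

/-- The four unit vectors of the grid. -/
def unitSteps : Finset GridPt := {(1, 0), (-1, 0), (0, 1), (0, -1)}

theorem mem_unitSteps {s : GridPt} :
    s ∈ unitSteps ↔ s = (1, 0) ∨ s = (-1, 0) ∨ s = (0, 1) ∨ s = (0, -1) := by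
  simp [unitSteps]

/-- The grid point reached from `p` by `k` steps `s`. -/
def run (p s : GridPt) (k : ℕ) : GridPt := (p.1 + k * s.1, p.2 + k * s.2)

/-- The edge `e` consists of `n` unit steps `s`. -/
def IsRun (e : GridPt × GridPt) (s : GridPt) (n : ℕ) : Prop :=
  s ∈ unitSteps ∧ 0 < n ∧ e.2 = run e.1 s n

theorem exists_isRun {e : GridPt × GridPt} (h : AxisParallel e) (hne : e.1 ≠ e.2) :
    ∃ s n, IsRun e s n := by
  obtain ⟨⟨a, b⟩, ⟨c, d⟩⟩ := e
  simp only [AxisParallel, ne_eq, Prod.mk.injEq] at h hne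
  simp only [IsRun, mem_unitSteps, run]
  rcases h with rfl | rfl
  · rcases lt_or_gt_of_ne (show b ≠ d by tauto) with h | h
    · exact ⟨(0, 1), (d - b).toNat, by simp, by omega, by ext <;> simp; omega⟩
    · exact ⟨(0, -1), (b - d).toNat, by simp, by omega, by ext <;> simp; omega⟩
  · rcases lt_or_gt_of_ne (show a ≠ c by tauto) with h | h
    · exact ⟨(1, 0), (c - a).toNat, by simp, by omega, by ext <;> simp; omega⟩
    · exact ⟨(-1, 0), (a - c).toNat, by simp, by omega, by ext <;> simp; omega⟩

theorem run_injective {p s : GridPt} (hs : s ∈ unitSteps) {k l : ℕ} (h : run p s k = run p s l) :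
    k = l := by
  rcases mem_unitSteps.1 hs with rfl | rfl | rfl | rfl <;> simpa [run] using h

theorem IsRun.unique {e : GridPt × GridPt} {s s' : GridPt} {n n' : ℕ} (h : IsRun e s n)
    (h' : IsRun e s' n') : s = s' ∧ n = n' := by
  obtain ⟨hs, hn, h⟩ := h
  obtain ⟨hs', hn', h'⟩ := h'
  rw [h] at h'
  rcases mem_unitSteps.1 hs with rfl | rfl | rfl | rfl <;>
  rcases mem_unitSteps.1 hs' with rfl | rfl | rfl | rfl <;>
  simp [run] at h' ⊢ <;> omega

theorem run_zero (p s : GridPt) : run p s 0 = p := by simp [run]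

theorem run_succ (p s : GridPt) (k : ℕ) : run p s (k + 1) = run p s k + s := by
  ext <;> simp [run] <;> ring

theorem IsRun.mem_seg_iff {e : GridPt × GridPt} {s : GridPt} {n : ℕ} (h : IsRun e s n)
    {x : Plane} : x ∈ seg e ↔
      ∃ t : ℝ, 0 ≤ t ∧ t ≤ n ∧ x = ((e.1.1 : ℝ) + t * s.1, (e.1.2 : ℝ) + t * s.2) := by
  obtain ⟨-, hn, h⟩ := h
  have hn' : (0 : ℝ) < n := by exact_mod_cast hn
  unfold seg
  rw [segment_eq_image', h]
  constructor
  · rintro ⟨θ, ⟨h0, h1⟩, rfl⟩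
    refine ⟨θ * n, by positivity, mul_le_of_le_one_left hn'.le h1, ?_⟩
    ext <;> simp [GridPt.toPlane, run] <;> ring
  · rintro ⟨t, h0, h1, rfl⟩
    refine ⟨t / n, ⟨by positivity, div_le_one_of_le₀ h1 hn'.le⟩, ?_⟩
    ext <;> simp [GridPt.toPlane, run] <;> field_simp

theorem mem_seg_add {p s : GridPt} (hs : s ∈ unitSteps) {x : Plane} : x ∈ seg (p, p + s) ↔
    ∃ t : ℝ, 0 ≤ t ∧ t ≤ 1 ∧ x = ((p.1 : ℝ) + t * s.1, (p.2 : ℝ) + t * s.2) := by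
  have : IsRun (p, p + s) s 1 := ⟨hs, one_pos, by ext <;> simp [run]⟩
  simpa using this.mem_seg_iff

namespace Frame

variable {f : Frame}

/-- The frame contains a unit step from `p` to `q` (in its direction of traversal). -/
def Dart (f : Frame) (p q : GridPt) : Prop :=
  ∃ e ∈ cycleEdges f.verts, ∃ s n k, IsRun e s n ∧ k < n ∧ p = run e.1 s k ∧ q = run e.1 s (k + 1)

theorem Dart.exists_step {p q : GridPt} (h : f.Dart p q) : ∃ s ∈ unitSteps, q = p + s := by
  obtain ⟨e, he, s, n, k, hr, hk, rfl, rfl⟩ := h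
  exact ⟨s, hr.1, run_succ _ _ _⟩

theorem mem_points_iff {x : Plane} : x ∈ f.points ↔ ∃ p q, f.Dart p q ∧ x ∈ seg (p, q) := by
  constructor
  · rintro ⟨e, he, hx⟩
    obtain ⟨s, n, hr⟩ := exists_isRun (f.axis e he) (f.fst_ne_snd he)
    obtain ⟨t, h0, h1, rfl⟩ := hr.mem_seg_iff.1 hx
    obtain ⟨k, hk, hkt, htk⟩ : ∃ k : ℕ, k < n ∧ (k : ℝ) ≤ t ∧ t ≤ k + 1 := by
      rcases h1.lt_or_eq with h | rfl
      · exact ⟨⌊t⌋₊, (Nat.floor_lt h0).2 h, Nat.floor_le h0, (Nat.lt_floor_add_one t).le⟩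
      · have := hr.2.1
        refine ⟨n - 1, by omega, by simp, ?_⟩
        exact_mod_cast (show n ≤ n - 1 + 1 by omega)
    refine ⟨_, _, ⟨e, he, s, n, k, hr, hk, rfl, rfl⟩, ?_⟩
    rw [run_succ, mem_seg_add hr.1]
    refine ⟨t - k, by linarith, by linarith, ?_⟩
    ext <;> simp [run] <;> ring
  · rintro ⟨p, q, ⟨e, he, s, n, k, hr, hk, rfl, rfl⟩, hx⟩
    rw [run_succ, mem_seg_add hr.1] at hx
    obtain ⟨t, h0, h1, rfl⟩ := hx
    have hk' : (k : ℝ) + 1 ≤ n := by exact_mod_cast hk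
    refine ⟨e, he, hr.mem_seg_iff.2 ⟨k + t, by positivity, by linarith, ?_⟩⟩
    ext <;> simp [run] <;> ring

theorem run_mem_seg {e : GridPt × GridPt} {s : GridPt} {n k : ℕ} (hr : IsRun e s n) (hk : k ≤ n) :
    (run e.1 s k).toPlane ∈ seg e :=
  hr.mem_seg_iff.2 ⟨k, by positivity, by exact_mod_cast hk, by simp [run, GridPt.toPlane]⟩

theorem run_ne_snd {e : GridPt × GridPt} {s : GridPt} {n k : ℕ} (hr : IsRun e s n) (hk : k < n) :
    run e.1 s k ≠ e.2 := by
  intro h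
  rw [hr.2.2] at h
  exact hk.ne (run_injective hr.1 h)

theorem run_ne_fst {e : GridPt × GridPt} {s : GridPt} {n k : ℕ} (hr : IsRun e s n) (hk : 0 < k) :
    run e.1 s k ≠ e.1 := by
  intro h
  rw [← run_zero e.1 s, run_zero e.1 s] at h
  exact hk.ne' (run_injective hr.1 (h.trans (run_zero e.1 s).symm))

/-- Two different edges share only common endpoints. Since `k < n`, a step does not start at the end
of its edge, so `p` would be the first vertex of both edges, and the vertices of a frame are
distinct. -/
theorem Dart.unique_out {p q q' : GridPt} (h : f.Dart p q) (h' : f.Dart p q') : q = q' := by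
  obtain ⟨e, he, s, n, k, hr, hk, rfl, rfl⟩ := h
  obtain ⟨e', he', s', n', k', hr', hk', hp, rfl⟩ := h'
  by_cases hee : e = e'
  · subst hee
    obtain ⟨rfl, rfl⟩ := hr.unique hr'
    rw [run_injective hr.1 hp]
  · have := f.plane.endpoints he he' hee (run_mem_seg hr hk.le) (hp ▸ run_mem_seg hr' hk'.le)
    have h1 := this.1.resolve_right (run_ne_snd hr hk)
    have h2 := this.2.resolve_right (hp ▸ run_ne_snd hr' hk')
    exact (hee (f.eq_of_fst_eq he he' (h1.symm.trans h2))).elim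

theorem Dart.unique_in {p p' q : GridPt} (h : f.Dart p q) (h' : f.Dart p' q) : p = p' := by
  obtain ⟨e, he, s, n, k, hr, hk, rfl, rfl⟩ := h
  obtain ⟨e', he', s', n', k', hr', hk', rfl, hp⟩ := h'
  by_cases hee : e = e'
  · subst hee
    obtain ⟨rfl, rfl⟩ := hr.unique hr'
    have := run_injective hr.1 hp
    rw [show k = k' by omega]
  · have := f.plane.endpoints he he' hee (run_mem_seg hr hk) (hp ▸ run_mem_seg hr' hk')
    have h1 := this.1.resolve_left (run_ne_fst hr k.succ_pos)
    have h2 := this.2.resolve_left (hp ▸ run_ne_fst hr' k'.succ_pos)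
    exact (hee (f.eq_of_snd_eq he he' (h1.symm.trans h2))).elim

theorem Dart.exists_out {p q : GridPt} (h : f.Dart p q) : ∃ r, f.Dart q r := by
  obtain ⟨e, he, s, n, k, hr, hk, rfl, rfl⟩ := h
  rcases (show k + 1 ≤ n from hk).lt_or_eq with hk | hk
  · exact ⟨_, e, he, s, n, k + 1, hr, hk, rfl, rfl⟩
  · obtain ⟨e', he', h⟩ := f.exists_next he
    obtain ⟨s', n', hr'⟩ := exists_isRun (f.axis e' he') (f.fst_ne_snd he')
    refine ⟨_, e', he', s', n', 0, hr', hr'.2.1, ?_, rfl⟩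
    rw [run_zero, h, hk, hr.2.2]

theorem Dart.exists_in {p q : GridPt} (h : f.Dart p q) : ∃ o, f.Dart o p := by
  obtain ⟨e, he, s, n, k, hr, hk, rfl, rfl⟩ := h
  rcases Nat.eq_zero_or_pos k with rfl | hk'
  · obtain ⟨e', he', h⟩ := f.exists_prev he
    obtain ⟨s', n', hr'⟩ := exists_isRun (f.axis e' he') (f.fst_ne_snd he')
    have := hr'.2.1
    refine ⟨_, e', he', s', n', n' - 1, hr', by omega, rfl, ?_⟩
    rw [run_zero, ← h, Nat.sub_add_cancel this, hr'.2.2]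
  · refine ⟨_, e, he, s, n, k - 1, hr, by omega, rfl, ?_⟩
    rw [Nat.sub_add_cancel hk']

/-- Within one edge all steps have the same direction. Two different edges would have both `p` and
`q` as endpoints, which makes one the reverse of the other. -/
theorem Dart.swap {p q : GridPt} (h : f.Dart p q) : ¬ f.Dart q p := by
  rintro h'
  obtain ⟨e, he, s, n, k, hr, hk, rfl, rfl⟩ := h
  obtain ⟨e', he', s', n', k', hr', hk', hp, hq⟩ := h'
  by_cases hee : e = e'
  · subst hee
    obtain ⟨rfl, rfl⟩ := hr.unique hr'
    have h1 := run_injective hr.1 hp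
    have h2 := run_injective hr.1 hq
    omega
  · have h1 := f.plane.endpoints he he' hee (run_mem_seg hr hk.le) (hq ▸ run_mem_seg hr' hk')
    have h2 := f.plane.endpoints he he' hee (run_mem_seg hr hk) (hp ▸ run_mem_seg hr' hk'.le)
    have a1 := h1.1.resolve_right (run_ne_snd hr hk)
    have a2 := h1.2.resolve_left (hq ▸ run_ne_fst hr' k'.succ_pos)
    have b1 := h2.1.resolve_left (run_ne_fst hr k.succ_pos)
    have b2 := h2.2.resolve_right (hp ▸ run_ne_snd hr' hk')
    apply f.swap_notMem he
    convert he'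
    · exact b1.symm.trans b2
    · exact a1.symm.trans a2

/-- A property of unit steps of a frame that passes to the next step holds for all steps as soon as
it holds for one. -/
theorem dart_induction {Q : GridPt → GridPt → Prop}
    (hQ : ∀ p q r, f.Dart p q → f.Dart q r → Q p q → Q q r) {p q p' q' : GridPt}
    (h : f.Dart p q) (h' : f.Dart p' q') (hpq : Q p q) : Q p' q' := by
  obtain ⟨e, he, s, n, k, hr, hk, rfl, rfl⟩ := h
  obtain ⟨e', he', s', n', k', hr', hk', rfl, rfl⟩ := h'
  have up : ∀ e ∈ cycleEdges f.verts, ∀ s n k, IsRun e s n → k < n →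
      Q (run e.1 s k) (run e.1 s (k + 1)) → ∀ m, k + m < n →
      Q (run e.1 s (k + m)) (run e.1 s (k + m + 1)) := by
    intro e he s n k hr hk h m
    induction m with
    | zero => exact fun _ => h
    | succ m ih =>
      exact fun hm => hQ _ _ _ ⟨e, he, s, n, k + m, hr, by omega, rfl, rfl⟩
        ⟨e, he, s, n, k + (m + 1), hr, hm, rfl, rfl⟩ (ih (by omega))
  -- It is enough to reach the first step of `e'`. The partial run in `e` is followed to its end,
  -- and from the next edge on `edge_induction` only handles whole edges, even if `e' = e`.
  have key : ∃ s n, IsRun e' s n ∧ Q (run e'.1 s 0) (run e'.1 s 1) := by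
    obtain ⟨e₁, he₁, h1⟩ := f.exists_next he
    have next : ∀ e ∈ cycleEdges f.verts, ∀ e' ∈ cycleEdges f.verts, e'.1 = e.2 →
        ∀ s n k, IsRun e s n → k < n → Q (run e.1 s k) (run e.1 s (k + 1)) →
        ∃ s n, IsRun e' s n ∧ Q (run e'.1 s 0) (run e'.1 s 1) := by
      intro e he e' he' hee s n k hr hk h
      obtain ⟨s', n', hr'⟩ := exists_isRun (f.axis e' he') (f.fst_ne_snd he')
      have h2 := up e he s n k hr hk h (n - 1 - k) (by omega)
      rw [show k + (n - 1 - k) + 1 = n by omega, ← hr.2.2, ← hee] at h2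
      refine ⟨s', n', hr', ?_⟩
      rw [run_zero]
      refine hQ _ _ _ ⟨e, he, s, n, k + (n - 1 - k), hr, by omega, rfl, ?_⟩
        ⟨e', he', s', n', 0, hr', hr'.2.1, ?_, rfl⟩ h2
      · rw [show k + (n - 1 - k) + 1 = n by omega, ← hr.2.2, ← hee]
      · rw [run_zero]
    refine f.edge_induction (Q := fun e' => ∃ s n, IsRun e' s n ∧ Q (run e'.1 s 0) (run e'.1 s 1))
      ?_ he₁ he' (next e he e₁ he₁ h1 s n k hr hk hpq)
    rintro a ha b hb hab ⟨s, n, hr, h⟩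
    exact next a ha b hb hab s n 0 hr hr.2.1 h
  obtain ⟨s, n, hr₂, h2⟩ := key
  obtain ⟨rfl, rfl⟩ := hr₂.unique hr'
  simpa using up e' he' s n 0 hr' hr'.2.1 h2 k' (by omega)

end Frame

/-! ### Curves made of unit edges -/

/-- The horizontal unit edge with left end `(i, j)`. -/
def hseg (i j : ℤ) : Set Plane := {x | (i : ℝ) ≤ x.1 ∧ x.1 ≤ i + 1 ∧ x.2 = j}

/-- The vertical unit edge with lower end `(i, j)`. -/
def vseg (i j : ℤ) : Set Plane := {x | x.1 = i ∧ (j : ℝ) ≤ x.2 ∧ x.2 ≤ j + 1}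

/-- A set of unit edges, given by the indicators `h` and `v` of its horizontal and vertical edges,
has even degree at every grid point. -/
def EvenDegree (h v : ℤ → ℤ → ZMod 2) : Prop :=
  ∀ i j, h i j + h (i - 1) j + v i j + v i (j - 1) = 0

/-- `S` is the union of finitely many unit edges, which form a nonempty minimal set of even
degree. -/
structure GridCurve (S : Set Plane) (h v : ℤ → ℤ → ZMod 2) : Prop where
  mem_iff : ∀ x, x ∈ S ↔ ∃ i j, (h i j = 1 ∧ x ∈ hseg i j) ∨ (v i j = 1 ∧ x ∈ vseg i j)
  bounded : ∃ B : ℤ, ∀ i j, h i j = 1 ∨ v i j = 1 → |i| < B ∧ |j| < B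
  even : EvenDegree h v
  irreducible : ∀ φ ψ : ℤ → ℤ → ZMod 2, (∀ i j, h i j = 0 → φ i j = 0) →
    (∀ i j, v i j = 0 → ψ i j = 0) → EvenDegree φ ψ →
    (∀ i j, φ i j = 0 ∧ ψ i j = 0) ∨ (∀ i j, φ i j = h i j ∧ ψ i j = v i j)

theorem zmod_two_cases (a : ZMod 2) : a = 0 ∨ a = 1 := by
  revert a; decide

theorem seg_right (i j : ℤ) : seg ((i, j), (i + 1, j)) = hseg i j := by
  ext x
  have := mem_seg_add (p := (i, j)) (s := (1, 0)) (by simp [unitSteps]) (x := x)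
  simp only [Prod.mk_add_mk, add_zero] at this
  rw [this]
  constructor
  · rintro ⟨t, h0, h1, rfl⟩
    simp [hseg, h0, h1]
  · rintro ⟨h0, h1, h2⟩
    exact ⟨x.1 - i, by linarith, by linarith, by ext <;> simp [h2]⟩

theorem seg_up (i j : ℤ) : seg ((i, j), (i, j + 1)) = vseg i j := by
  ext x
  have := mem_seg_add (p := (i, j)) (s := (0, 1)) (by simp [unitSteps]) (x := x)
  simp only [Prod.mk_add_mk, add_zero] at this
  rw [this]
  constructor
  · rintro ⟨t, h0, h1, rfl⟩
    simp [vseg, h0, h1]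
  · rintro ⟨h2, h0, h1⟩
    exact ⟨x.2 - j, by linarith, by linarith, by ext <;> simp [h2]⟩

namespace Frame

variable {f : Frame}

/-- The frame contains the unit edge `pq`. -/
def UnitEdge (f : Frame) (p q : GridPt) : Prop := f.Dart p q ∨ f.Dart q p

theorem UnitEdge.symm {p q : GridPt} (h : f.UnitEdge p q) : f.UnitEdge q p := Or.symm h

open Classical in
/-- The indicator of the horizontal unit edges of a frame. -/
noncomputable def hor (f : Frame) (i j : ℤ) : ZMod 2 :=
  if f.UnitEdge (i, j) (i + 1, j) then 1 else 0

open Classical in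
/-- The indicator of the vertical unit edges of a frame. -/
noncomputable def ver (f : Frame) (i j : ℤ) : ZMod 2 :=
  if f.UnitEdge (i, j) (i, j + 1) then 1 else 0

theorem hor_eq_one {i j : ℤ} : f.hor i j = 1 ↔ f.UnitEdge (i, j) (i + 1, j) := by
  simp [hor]

theorem ver_eq_one {i j : ℤ} : f.ver i j = 1 ↔ f.UnitEdge (i, j) (i, j + 1) := by
  simp [ver]

theorem hor_eq_zero {i j : ℤ} : f.hor i j = 0 ↔ ¬ f.UnitEdge (i, j) (i + 1, j) := by
  simp [hor]

theorem ver_eq_zero {i j : ℤ} : f.ver i j = 0 ↔ ¬ f.UnitEdge (i, j) (i, j + 1) := by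
  simp [ver]

theorem mem_points_iff_hor_ver (x : Plane) : x ∈ f.points ↔
    ∃ i j, (f.hor i j = 1 ∧ x ∈ hseg i j) ∨ (f.ver i j = 1 ∧ x ∈ vseg i j) := by
  simp only [hor_eq_one, ver_eq_one, ← seg_right, ← seg_up]
  rw [f.mem_points_iff]
  constructor
  · rintro ⟨⟨i, j⟩, q, hd, hx⟩
    obtain ⟨s, hs, rfl⟩ := hd.exists_step
    rcases mem_unitSteps.1 hs with rfl | rfl | rfl | rfl
    · simp only [Prod.mk_add_mk, add_zero] at hd hx
      exact ⟨i, j, .inl ⟨.inl hd, hx⟩⟩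
    · refine ⟨i - 1, j, .inl ?_⟩
      rw [seg_swap] at hx
      simp only [Prod.mk_add_mk, add_zero, ← sub_eq_add_neg] at hd hx
      simpa using ⟨.inr hd, hx⟩
    · simp only [Prod.mk_add_mk, add_zero] at hd hx
      exact ⟨i, j, .inr ⟨.inl hd, hx⟩⟩
    · refine ⟨i, j - 1, .inr ?_⟩
      rw [seg_swap] at hx
      simp only [Prod.mk_add_mk, add_zero, ← sub_eq_add_neg] at hd hx
      simpa using ⟨.inr hd, hx⟩
  · rintro ⟨i, j, ⟨h | h, hx⟩ | ⟨h | h, hx⟩⟩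
    · exact ⟨_, _, h, hx⟩
    · exact ⟨_, _, h, seg_swap _ _ ▸ hx⟩
    · exact ⟨_, _, h, hx⟩
    · exact ⟨_, _, h, seg_swap _ _ ▸ hx⟩

theorem neg_mem_unitSteps {s : GridPt} (hs : s ∈ unitSteps) : -s ∈ unitSteps := by
  rcases mem_unitSteps.1 hs with rfl | rfl | rfl | rfl <;> decide

/-- A grid point on the frame has one incoming and one outgoing step, so of the four unit edges
around it only two can contribute. -/
theorem sum_unitSteps {Φ : GridPt → GridPt → ZMod 2} {o p q : GridPt} (hop : f.Dart o p)
    (hpq : f.Dart p q) (hΦ : ∀ s ∈ unitSteps, ¬ f.UnitEdge p (p + s) → Φ p (p + s) = 0) :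
    ∑ s ∈ unitSteps, Φ p (p + s) = Φ p o + Φ p q := by
  obtain ⟨s, hs, rfl⟩ := hpq.exists_step
  obtain ⟨s', hs', hp⟩ := hop.exists_step
  obtain rfl : o = p + -s' := by rw [hp]; abel
  have hne : -s' ≠ s := by
    rintro rfl
    exact hop.swap hpq
  rw [← Finset.sum_pair (f := fun s => Φ p (p + s)) hne]
  symm
  refine Finset.sum_subset ?_ ?_
  · intro x hx
    simp only [Finset.mem_insert, Finset.mem_singleton] at hx
    rcases hx with rfl | rfl
    · exact neg_mem_unitSteps hs'
    · exact hs
  · intro x hx hx'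
    apply hΦ x hx
    simp only [Finset.mem_insert, Finset.mem_singleton, not_or] at hx'
    rintro (h | h)
    · exact hx'.2 (add_left_cancel (h.unique_out hpq))
    · exact hx'.1 (add_left_cancel (h.unique_in hop))

/-- The function on pairs of neighbouring grid points that is given by functions on horizontal and
on vertical unit edges. -/
def edgeFun (φ ψ : ℤ → ℤ → ZMod 2) (p q : GridPt) : ZMod 2 :=
  if p.2 = q.2 then φ (min p.1 q.1) (min p.2 q.2) else ψ (min p.1 q.1) (min p.2 q.2)

theorem edgeFun_symm (φ ψ : ℤ → ℤ → ZMod 2) (p q : GridPt) :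
    edgeFun φ ψ p q = edgeFun φ ψ q p := by
  simp only [edgeFun, min_comm p.1, min_comm p.2, eq_comm (a := p.2)]

theorem edgeFun_right (φ ψ : ℤ → ℤ → ZMod 2) (i j : ℤ) :
    edgeFun φ ψ (i, j) (i + 1, j) = φ i j := by simp [edgeFun]

theorem edgeFun_up (φ ψ : ℤ → ℤ → ZMod 2) (i j : ℤ) :
    edgeFun φ ψ (i, j) (i, j + 1) = ψ i j := by simp [edgeFun]

theorem edgeFun_left (φ ψ : ℤ → ℤ → ZMod 2) (i j : ℤ) :
    edgeFun φ ψ (i, j) (i - 1, j) = φ (i - 1) j := by simp [edgeFun]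

theorem edgeFun_down (φ ψ : ℤ → ℤ → ZMod 2) (i j : ℤ) :
    edgeFun φ ψ (i, j) (i, j - 1) = ψ i (j - 1) := by
  rw [edgeFun, if_neg (by dsimp only; omega)]; simp

theorem sum_edgeFun (φ ψ : ℤ → ℤ → ZMod 2) (p : GridPt) :
    ∑ s ∈ unitSteps, edgeFun φ ψ p (p + s) =
      φ p.1 p.2 + φ (p.1 - 1) p.2 + ψ p.1 p.2 + ψ p.1 (p.2 - 1) := by
  obtain ⟨i, j⟩ := p
  simp only [unitSteps]
  rw [Finset.sum_insert (by decide), Finset.sum_insert (by decide), Finset.sum_insert (by decide),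
    Finset.sum_singleton]
  simp only [Prod.mk_add_mk, add_zero, ← sub_eq_add_neg, edgeFun_right, edgeFun_up, edgeFun_left,
    edgeFun_down]
  ring

theorem edgeFun_eq_zero {φ ψ : ℤ → ℤ → ZMod 2} (hφ : ∀ i j, f.hor i j = 0 → φ i j = 0)
    (hψ : ∀ i j, f.ver i j = 0 → ψ i j = 0) {p s : GridPt} (hs : s ∈ unitSteps)
    (h : ¬ f.UnitEdge p (p + s)) : edgeFun φ ψ p (p + s) = 0 := by
  obtain ⟨i, j⟩ := p
  rcases mem_unitSteps.1 hs with rfl | rfl | rfl | rfl <;>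
    simp only [Prod.mk_add_mk, add_zero, ← sub_eq_add_neg] at h ⊢
  · rw [edgeFun_right]
    exact hφ _ _ (hor_eq_zero.2 h)
  · rw [edgeFun_left]
    exact hφ _ _ (hor_eq_zero.2 fun h' => h (by simpa using h'.symm))
  · rw [edgeFun_up]
    exact hψ _ _ (ver_eq_zero.2 h)
  · rw [edgeFun_down]
    exact hψ _ _ (ver_eq_zero.2 fun h' => h (by simpa using h'.symm))

theorem edgeFun_hor_ver {p q : GridPt} (h : f.Dart p q) : edgeFun f.hor f.ver p q = 1 := by
  obtain ⟨s, hs, rfl⟩ := h.exists_step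
  obtain ⟨i, j⟩ := p
  rcases mem_unitSteps.1 hs with rfl | rfl | rfl | rfl <;>
    simp only [Prod.mk_add_mk, add_zero, ← sub_eq_add_neg] at h ⊢
  · rw [edgeFun_right, hor_eq_one]
    exact .inl h
  · rw [edgeFun_left, hor_eq_one]
    exact .inr (by simpa using h)
  · rw [edgeFun_up, ver_eq_one]
    exact .inl h
  · rw [edgeFun_down, ver_eq_one]
    exact .inr (by simpa using h)

theorem exists_dart (f : Frame) : ∃ p q, f.Dart p q := by
  have := f.three_le
  have hpos : 0 < f.verts.length := by omega
  have he := mem_cycleEdges.2 ⟨0, hpos, rfl⟩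
  obtain ⟨s, n, hr⟩ := exists_isRun (f.axis _ he) (f.fst_ne_snd he)
  exact ⟨_, _, _, he, s, n, 0, hr, hr.2.1, rfl, rfl⟩

/-- Evenness holds because steps enter and leave each grid point equally often, at most once. For
minimality, an even subset takes equal values on consecutive steps, hence is constant along the
frame: it is empty or everything. -/
theorem gridCurve (f : Frame) : GridCurve f.points f.hor f.ver where
  mem_iff := mem_points_iff_hor_ver
  bounded := by
    obtain ⟨r, hr⟩ := f.isCompact_points.isBounded.exists_norm_le
    obtain ⟨B, hB⟩ := exists_int_gt r
    refine ⟨B, fun i j h => ?_⟩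
    have h1 : (((i : ℝ), (j : ℝ)) : Plane) ∈ f.points := by
      refine (mem_points_iff_hor_ver _).2 ⟨i, j, ?_⟩
      rcases h with h | h
      · exact .inl ⟨h, by simp [hseg]⟩
      · exact .inr ⟨h, by simp [vseg]⟩
    have h2 := (hr _ h1).trans_lt hB
    rw [Prod.norm_def, max_lt_iff] at h2
    simp only [Real.norm_eq_abs] at h2
    exact ⟨by exact_mod_cast h2.1, by exact_mod_cast h2.2⟩
  even := by
    intro i j
    rw [← sum_edgeFun f.hor f.ver (i, j)]
    by_cases h : ∃ q, f.Dart (i, j) q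
    · obtain ⟨q, h⟩ := h
      obtain ⟨o, h'⟩ := h.exists_in
      rw [sum_unitSteps h' h fun s hs => edgeFun_eq_zero (fun _ _ => id) (fun _ _ => id) hs,
        edgeFun_hor_ver h, edgeFun_symm, edgeFun_hor_ver h']
      decide
    · refine Finset.sum_eq_zero fun s hs =>
        edgeFun_eq_zero (fun _ _ => id) (fun _ _ => id) hs ?_
      rintro (h' | h')
      · exact h ⟨_, h'⟩
      · exact h h'.exists_out
  irreducible := by
    intro φ ψ hφ hψ he
    obtain ⟨p₀, q₀, h₀⟩ := f.exists_dart
    have key : ∀ p q, f.Dart p q → edgeFun φ ψ p q = edgeFun φ ψ p₀ q₀ := by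
      intro p q h
      refine f.dart_induction (Q := fun p q => edgeFun φ ψ p q = edgeFun φ ψ p₀ q₀) ?_ h₀ h rfl
      intro o p q hop hpq h
      -- The degree of the subset at `p` is the sum of its values on the two steps through `p`;
      -- being zero modulo 2, it forces these values to agree.
      have h1 := sum_unitSteps hop hpq fun s hs => edgeFun_eq_zero hφ hψ hs
      rw [sum_edgeFun, he p.1 p.2, edgeFun_symm, h] at h1
      generalize edgeFun φ ψ p q = a at h1 ⊢
      generalize edgeFun φ ψ p₀ q₀ = b at h1 ⊢
      revert a b; decide
    have key' : ∀ p q, f.UnitEdge p q → edgeFun φ ψ p q = edgeFun φ ψ p₀ q₀ := by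
      rintro p q (h | h)
      · exact key p q h
      · rw [edgeFun_symm]; exact key q p h
    have hor' : ∀ i j, f.hor i j = 1 → φ i j = edgeFun φ ψ p₀ q₀ := fun i j h => by
      rw [← key' _ _ (hor_eq_one.1 h), edgeFun_right]
    have ver' : ∀ i j, f.ver i j = 1 → ψ i j = edgeFun φ ψ p₀ q₀ := fun i j h => by
      rw [← key' _ _ (ver_eq_one.1 h), edgeFun_up]
    rcases zmod_two_cases (edgeFun φ ψ p₀ q₀) with h | h
    · left
      intro i j
      constructor
      · rcases zmod_two_cases (f.hor i j) with h1 | h1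
        · exact hφ _ _ h1
        · rw [hor' i j h1, h]
      · rcases zmod_two_cases (f.ver i j) with h1 | h1
        · exact hψ _ _ h1
        · rw [ver' i j h1, h]
    · right
      intro i j
      constructor
      · rcases zmod_two_cases (f.hor i j) with h1 | h1
        · rw [hφ _ _ h1, h1]
        · rw [hor' i j h1, h, h1]
      · rcases zmod_two_cases (f.ver i j) with h1 | h1
        · rw [hψ _ _ h1, h1]
        · rw [ver' i j h1, h, h1]

end Frame

/-! ### Inside and outside of a curve made of unit edges -/

/-- `N` is a function with bounded support on the unit cells (indexed by their lower left corners)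
whose differences across the unit edges are given by `h` and `v`. -/
structure IsPotential (N h v : ℤ → ℤ → ZMod 2) : Prop where
  ver : ∀ i j, N i j = N (i - 1) j + v i j
  hor : ∀ i j, N i j = N i (j - 1) + h i j
  bounded : ∃ B : ℤ, ∀ i j, N i j ≠ 0 → |i| < B ∧ |j| < B

theorem eq_of_eq_pred {α : Type*} {g : ℤ → α} (h : ∀ i, g i = g (i - 1)) (i j : ℤ) : g i = g j := by
  have key : ∀ i, g i = g 0 := by
    intro i
    induction i using Int.induction_on with
    | zero => rfl
    | succ n ih => rw [h, add_sub_cancel_right, ih]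
    | pred n ih => rw [← h, ih]
  rw [key i, key j]

theorem IsPotential.add {N N' h h' v v' : ℤ → ℤ → ZMod 2} (H : IsPotential N h v)
    (H' : IsPotential N' h' v') :
    IsPotential (fun i j => N i j + N' i j) (fun i j => h i j + h' i j)
      (fun i j => v i j + v' i j) where
  ver i j := by rw [H.ver, H'.ver]; ring
  hor i j := by rw [H.hor, H'.hor]; ring
  bounded := by
    obtain ⟨B, hB⟩ := H.bounded
    obtain ⟨B', hB'⟩ := H'.bounded
    refine ⟨max B B', fun i j hij => ?_⟩
    simp only [lt_max_iff]
    by_cases h0 : N i j = 0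
    · have := hB' i j fun h1 => hij (by rw [h0, h1, add_zero])
      exact ⟨.inr this.1, .inr this.2⟩
    · have := hB i j h0
      exact ⟨.inl this.1, .inl this.2⟩

theorem IsPotential.eq_zero {N : ℤ → ℤ → ZMod 2} (H : IsPotential N 0 0) (i j : ℤ) :
    N i j = 0 := by
  obtain ⟨B, hB⟩ := H.bounded
  -- Without jumps a row is constant, and column `|B|` is outside the support whatever the sign of
  -- `B`.
  rw [eq_of_eq_pred (g := fun i => N i j) (fun i => by simpa using H.ver i j) i |B|]
  by_contra h
  have := (hB _ _ h).1
  rw [abs_abs] at this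
  exact (le_abs_self B).not_gt this

theorem IsPotential.unique {N N' h v : ℤ → ℤ → ZMod 2} (H : IsPotential N h v)
    (H' : IsPotential N' h v) (i j : ℤ) : N i j = N' i j := by
  have h0 : IsPotential (fun i j => N i j + N' i j) 0 0 := by
    convert H.add H' using 1 <;> ext i j <;> exact (CharTwo.add_self_eq_zero _).symm
  exact CharTwo.add_eq_zero.1 (h0.eq_zero i j)

namespace GridCurve

variable {S : Set Plane} {h v : ℤ → ℤ → ZMod 2}

/-- The potential of a cell is the parity of the vertical edges met on a ray going left from it, as
in the crossing test for polygons. -/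
theorem exists_isPotential (H : GridCurve S h v) : ∃ N, IsPotential N h v := by
  obtain ⟨B, hB⟩ := H.bounded
  have h0 : ∀ i j, (B ≤ |i| ∨ B ≤ |j|) → h i j = 0 := fun i j hij =>
    (zmod_two_cases _).resolve_right fun h1 => by have := hB i j (.inl h1); omega
  have v0 : ∀ i j, (B ≤ |i| ∨ B ≤ |j|) → v i j = 0 := fun i j hij =>
    (zmod_two_cases _).resolve_right fun h1 => by have := hB i j (.inr h1); omega
  let N : ℤ → ℤ → ZMod 2 := fun i j => ∑ k ∈ Finset.Icc (-B) i, v k j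
  have hlow : ∀ i j, i < -B → N i j = 0 := fun i j hi => by
    simp only [N, Finset.Icc_eq_empty (not_le.2 hi), Finset.sum_empty]
  have hrow : ∀ i j, B ≤ |j| → N i j = 0 := fun i j hj =>
    Finset.sum_eq_zero fun k _ => v0 k j (.inr hj)
  have hver : ∀ i j, N i j = N (i - 1) j + v i j := by
    intro i j
    rcases lt_or_ge i (-B) with hi | hi
    · rw [hlow _ _ hi, hlow _ _ (by omega), v0 _ _ (.inl (by rw [le_abs]; omega)), add_zero]
    · have : Finset.Icc (-B) i = insert i (Finset.Icc (-B) (i - 1)) := by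
        ext k; simp only [Finset.mem_Icc, Finset.mem_insert]; omega
      simp only [N, this]
      rw [Finset.sum_insert (by simp), add_comm]
  have hhor : ∀ i j, N i j = N i (j - 1) + h i j := by
    intro i j
    -- By the even degree at `(i, j)`, the defect in the rule for horizontal edges does not depend
    -- on the column. It vanishes far to the left.
    have key := eq_of_eq_pred (g := fun i => N i j + N i (j - 1) + h i j) (fun i => by
      have := H.even i j
      rw [hver i j, hver i (j - 1)]
      generalize N (i - 1) j = a, N (i - 1) (j - 1) = b, h i j = c, v i j = d, v i (j - 1) = e,
        h (i - 1) j = g at this ⊢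
      revert a b c d e g; decide) i (-|B| - 1)
    have hb := le_abs_self B
    have hn := neg_abs_le B
    rw [hlow (-|B| - 1) _ (by omega), hlow (-|B| - 1) _ (by omega),
      h0 (-|B| - 1) _ (.inl (by rw [le_abs]; omega))] at key
    generalize N i j = a, N i (j - 1) = b, h i j = c at key ⊢
    revert a b c; decide
  refine ⟨N, hver, hhor, |B| + 1, fun i j hij => ?_⟩
  have hb := le_abs_self B
  have hj : ¬ B ≤ |j| := fun hj => hij (hrow i j hj)
  have hi : ¬ i < -B := fun hi => hij (hlow i j hi)
  -- To the right of the curve no horizontal edges remain, so the potential is constant along a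
  -- column and vanishes high up.
  have hi' : ¬ B ≤ i := fun hi => by
    apply hij
    rw [eq_of_eq_pred (g := fun j => N i j) (fun j => by
      rw [hhor i j, h0 i j (.inl (hi.trans (le_abs_self i))), add_zero]) j |B|]
    exact hrow _ _ (by rw [abs_abs]; exact hb)
  have : |i| ≤ B := abs_le.2 ⟨by omega, by omega⟩
  omega

theorem center_notMem (H : GridCurve S h v) {x : Plane} {i j : ℤ} (h1 : i < x.1) (h2 : x.1 < i + 1)
    (h3 : j < x.2) (h4 : x.2 < j + 1) : x ∉ S := by
  rw [H.mem_iff]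
  rintro ⟨k, l, ⟨-, -, -, hx⟩ | ⟨-, hx, -⟩⟩
  · rw [hx] at h3 h4
    norm_cast at h3 h4
    omega
  · rw [hx] at h1 h2
    norm_cast at h1 h2
    omega

/-- A midpoint lies on a single unit edge, so the point set alone determines the indicators. -/
theorem hor_mid_mem_iff (H : GridCurve S h v) (i j : ℤ) :
    ((i : ℝ) + 1 / 2, (j : ℝ)) ∈ S ↔ h i j = 1 := by
  rw [H.mem_iff]
  constructor
  · rintro ⟨k, l, ⟨h1, h2, h3, h4⟩ | ⟨-, h2, -⟩⟩
    · simp only at h2 h3 h4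
      have h2 : (k : ℝ) < i + 1 := by linarith
      have h3 : (i : ℝ) < k + 1 := by linarith
      norm_cast at h2 h3 h4
      rw [h4, show i = k by omega, h1]
    · simp only at h2
      have h3 : (k : ℝ) < i + 1 := by linarith
      have h4 : (i : ℝ) < k := by linarith
      norm_cast at h3 h4
      omega
  · intro h1
    exact ⟨i, j, .inl ⟨h1, by simp, by dsimp only; linarith, rfl⟩⟩

theorem ver_mid_mem_iff (H : GridCurve S h v) (i j : ℤ) :
    ((i : ℝ), (j : ℝ) + 1 / 2) ∈ S ↔ v i j = 1 := by
  rw [H.mem_iff]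
  constructor
  · rintro ⟨k, l, ⟨-, -, -, h2⟩ | ⟨h1, h4, h2, h3⟩⟩
    · simp only at h2
      have h3 : (l : ℝ) < j + 1 := by linarith
      have h4 : (j : ℝ) < l := by linarith
      norm_cast at h3 h4
      omega
    · simp only at h2 h3 h4
      have h2 : (l : ℝ) < j + 1 := by linarith
      have h3 : (j : ℝ) < l + 1 := by linarith
      norm_cast at h2 h3 h4
      rw [h4, show j = l by omega, h1]
  · intro h1
    exact ⟨i, j, .inr ⟨h1, rfl, by simp, by dsimp only; linarith⟩⟩

end GridCurve

/-! ### Components of the complement, compared with the potential on cells -/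

theorem connectedComponentIn_eq_of_segment {F : Set Plane} {x y : Plane} (h : segment ℝ x y ⊆ F) :
    connectedComponentIn F x = connectedComponentIn F y :=
  connectedComponentIn_eq <| (convex_segment x y).isPreconnected.subset_connectedComponentIn
    (left_mem_segment ℝ x y) h (right_mem_segment ℝ x y)

theorem mem_connectedComponentIn_of_eq {F : Set Plane} {x y z : Plane} (hz : z ∈ F)
    (h : connectedComponentIn F y = connectedComponentIn F z) (hy : y ∈ connectedComponentIn F x) :
    z ∈ connectedComponentIn F x := by
  rw [connectedComponentIn_eq hy, h]
  exact mem_connectedComponentIn hz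

/-- The centre of a unit cell. -/
noncomputable def center (i j : ℤ) : Plane := ((i : ℝ) + 1 / 2, (j : ℝ) + 1 / 2)

namespace GridCurve

variable {S : Set Plane} {h v N : ℤ → ℤ → ZMod 2} (H : GridCurve S h v)

include H

/-- The segment from a point of the closed cell to the centre lies in the open cell apart from its
start, and the curve misses open cells. -/
theorem component_center {x : Plane} (hx : x ∉ S) {i j : ℤ} (h1 : i ≤ x.1) (h2 : x.1 ≤ i + 1)
    (h3 : j ≤ x.2) (h4 : x.2 ≤ j + 1) :
    connectedComponentIn Sᶜ x = connectedComponentIn Sᶜ (center i j) := by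
  apply connectedComponentIn_eq_of_segment
  rw [segment_eq_image']
  rintro _ ⟨θ, ⟨h0, h5⟩, rfl⟩
  rcases h0.eq_or_lt with rfl | h0
  · simpa using hx
  · refine H.center_notMem (i := i) (j := j) ?_ ?_ ?_ ?_ <;>
      simp only [center, Prod.fst_add, Prod.snd_add, Prod.smul_fst, Prod.smul_snd, Prod.fst_sub,
        Prod.snd_sub, smul_eq_mul] <;> nlinarith

theorem component_center_ver {i j : ℤ} (h0 : v i j = 0) :
    connectedComponentIn Sᶜ (center (i - 1) j) = connectedComponentIn Sᶜ (center i j) := by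
  have hx : ((i : ℝ), (j : ℝ) + 1 / 2) ∉ S := by
    rw [H.ver_mid_mem_iff, h0]; decide
  rw [← H.component_center hx (i := i) (j := j), ← H.component_center hx (i := i - 1) (j := j)] <;>
    simp <;> linarith

theorem component_center_hor {i j : ℤ} (h0 : h i j = 0) :
    connectedComponentIn Sᶜ (center i (j - 1)) = connectedComponentIn Sᶜ (center i j) := by
  have hx : ((i : ℝ) + 1 / 2, (j : ℝ)) ∉ S := by
    rw [H.hor_mid_mem_iff, h0]; decide
  rw [← H.component_center hx (i := i) (j := j), ← H.component_center hx (i := i) (j := j - 1)] <;>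
    simp <;> linarith

theorem center_mem_compl (i j : ℤ) : center i j ∈ Sᶜ := by
  refine H.center_notMem (i := i) (j := j) ?_ ?_ ?_ ?_ <;> simp [center] <;> linarith

theorem component_center_floor {x : Plane} (hx : x ∉ S) :
    connectedComponentIn Sᶜ x = connectedComponentIn Sᶜ (center ⌊x.1⌋ ⌊x.2⌋) :=
  H.component_center hx (Int.floor_le _) (Int.lt_floor_add_one _).le (Int.floor_le _)
    (Int.lt_floor_add_one _).le

end GridCurve

theorem eventually_floor_eq (a : ℝ) :
    ∀ᶠ b in nhds a, ⌊b⌋ = ⌊a⌋ ∨ (⌊b⌋ = ⌊a⌋ - 1 ∧ a = ⌊a⌋) := by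
  rcases (Int.floor_le a).eq_or_lt with h | h
  · filter_upwards [Ioo_mem_nhds (show a - 1 < a by linarith) (Int.lt_floor_add_one a)] with b hb
    rcases lt_or_ge b a with hab | hab
    · right
      refine ⟨Int.floor_eq_iff.2 ⟨?_, ?_⟩, h.symm⟩ <;> push_cast <;> linarith [hb.1]
    · left
      exact Int.floor_eq_iff.2 ⟨by linarith, hb.2⟩
  · filter_upwards [Ioo_mem_nhds h (Int.lt_floor_add_one a)] with b hb
    exact .inl (Int.floor_eq_iff.2 ⟨hb.1.le, hb.2⟩)

namespace GridCurve

variable {S : Set Plane} {h v N : ℤ → ℤ → ZMod 2} (H : GridCurve S h v)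

include H

/-- Near `x` the floors change only if `x` lies on a grid line. The unit edges crossed then contain
`x`, so they are not in the curve and the potential does not jump; at a grid point two such edges
are crossed in turn. -/
theorem eventually_potential_eq (hN : IsPotential N h v) {x : Plane} (hx : x ∉ S) :
    ∀ᶠ y in nhds x, N ⌊y.1⌋ ⌊y.2⌋ = N ⌊x.1⌋ ⌊x.2⌋ := by
  have h1 := (continuous_fst.tendsto x).eventually (eventually_floor_eq x.1)
  have h2 := (continuous_snd.tendsto x).eventually (eventually_floor_eq x.2)
  have hfl := Int.floor_le x.1
  have hfl' := Int.lt_floor_add_one x.1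
  have hfr := Int.floor_le x.2
  have hfr' := Int.lt_floor_add_one x.2
  generalize ⌊x.1⌋ = i at *
  generalize ⌊x.2⌋ = j at *
  have hv : x.1 = i → v i j = 0 := fun hi => (zmod_two_cases _).resolve_right fun h1 =>
    hx ((H.mem_iff x).2 ⟨i, j, .inr ⟨h1, hi, hfr, hfr'.le⟩⟩)
  have hh : x.2 = j → h i j = 0 := fun hj => (zmod_two_cases _).resolve_right fun h1 =>
    hx ((H.mem_iff x).2 ⟨i, j, .inl ⟨h1, hfl, hfl'.le, hj⟩⟩)
  have hh' : x.1 = i → x.2 = j → h (i - 1) j = 0 := fun hi hj =>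
    (zmod_two_cases _).resolve_right fun h1 =>
      hx ((H.mem_iff x).2 ⟨i - 1, j, .inl ⟨h1, by push_cast; linarith, by push_cast; linarith, hj⟩⟩)
  filter_upwards [h1, h2] with y hy1 hy2
  rcases hy1 with h1 | ⟨h1, hi⟩ <;> rcases hy2 with h2 | ⟨h2, hj⟩
  · rw [h1, h2]
  · rw [h1, h2, hN.hor i j, hh hj, add_zero]
  · rw [h1, h2, hN.ver i j, hv hi, add_zero]
  · rw [h1, h2, hN.ver i j, hv hi, add_zero, hN.hor (i - 1) j, hh' hi hj, add_zero]

theorem potential_eq_of_mem_component (hN : IsPotential N h v) {x y : Plane} (hx : x ∉ S)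
    (hy : y ∈ connectedComponentIn Sᶜ x) : N ⌊y.1⌋ ⌊y.2⌋ = N ⌊x.1⌋ ⌊x.2⌋ := by
  have hc : ContinuousOn (fun z : Plane => N ⌊z.1⌋ ⌊z.2⌋) (connectedComponentIn Sᶜ x) := by
    intro z hz
    have hz' : z ∉ S := connectedComponentIn_subset _ _ hz
    refine ContinuousAt.continuousWithinAt ?_
    refine Filter.Tendsto.congr' ?_ tendsto_const_nhds
    filter_upwards [H.eventually_potential_eq hN hz'] with w hw using hw.symm
  exact isPreconnected_connectedComponentIn.constant hc hy (mem_connectedComponentIn hx)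

/-- The bounded components of the complement of the curve are where the potential is `1`. -/
theorem isBounded_component_iff (hN : IsPotential N h v) {x : Plane} (hx : x ∉ S) :
    Bornology.IsBounded (connectedComponentIn Sᶜ x) ↔ N ⌊x.1⌋ ⌊x.2⌋ = 1 := by
  classical
  constructor
  · intro hb
    -- The indicator of the component on cell centres jumps only across edges of the curve, and its
    -- jumps have even degree. By minimality it jumps nowhere, which is impossible for a nonzero
    -- function of bounded support, or everywhere on the curve, and then it equals the potential.
    let χ : ℤ → ℤ → ZMod 2 := fun i j => if center i j ∈ connectedComponentIn Sᶜ x then 1 else 0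
    have hχ : ∀ i j, χ i j = if center i j ∈ connectedComponentIn Sᶜ x then 1 else 0 :=
      fun _ _ => rfl
    have congr_χ : ∀ i j k l, connectedComponentIn Sᶜ (center i j) =
        connectedComponentIn Sᶜ (center k l) → χ i j = χ k l := by
      intro i j k l h
      rw [hχ, hχ]
      congr 1
      exact propext ⟨mem_connectedComponentIn_of_eq (H.center_mem_compl k l) h,
        mem_connectedComponentIn_of_eq (H.center_mem_compl i j) h.symm⟩
    have hχx : χ ⌊x.1⌋ ⌊x.2⌋ = 1 := by
      rw [hχ, if_pos]
      exact mem_connectedComponentIn_of_eq (H.center_mem_compl _ _) (H.component_center_floor hx)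
        (mem_connectedComponentIn hx)
    have hbd : ∃ B : ℤ, ∀ i j, χ i j ≠ 0 → |i| < B ∧ |j| < B := by
      obtain ⟨r, hr⟩ := hb.exists_norm_le
      obtain ⟨B, hB⟩ := exists_int_gt (r + 1)
      refine ⟨B, fun i j hij => ?_⟩
      have hm : center i j ∈ connectedComponentIn Sᶜ x := by
        by_contra hm
        exact hij (by rw [hχ, if_neg hm])
      have h2 := hr _ hm
      rw [center, Prod.norm_def, max_le_iff] at h2
      simp only [Real.norm_eq_abs, abs_le] at h2
      constructor
      · have : |(i : ℝ)| < B := abs_lt.2 ⟨by linarith, by linarith⟩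
        exact_mod_cast this
      · have : |(j : ℝ)| < B := abs_lt.2 ⟨by linarith, by linarith⟩
        exact_mod_cast this
    rcases H.irreducible (fun i j => χ i (j - 1) + χ i j) (fun i j => χ (i - 1) j + χ i j)
      (fun i j h0 => by
        rw [congr_χ _ _ _ _ (H.component_center_hor h0), CharTwo.add_self_eq_zero])
      (fun i j h0 => by
        rw [congr_χ _ _ _ _ (H.component_center_ver h0), CharTwo.add_self_eq_zero])
      (fun i j => by
        dsimp only
        generalize χ i j = a, χ i (j - 1) = b, χ (i - 1) j = c, χ (i - 1) (j - 1) = d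
        revert a b c d; decide) with h0 | h0
    · have hp : IsPotential χ 0 0 := by
        refine ⟨fun i j => ?_, fun i j => ?_, hbd⟩
        · simpa using (CharTwo.add_eq_zero.1 (h0 i j).2).symm
        · simpa using (CharTwo.add_eq_zero.1 (h0 i j).1).symm
      rw [hp.eq_zero] at hχx
      exact absurd hχx (by decide)
    · have hp : IsPotential χ h v := by
        refine ⟨fun i j => ?_, fun i j => ?_, hbd⟩
        · rw [← (h0 i j).2, ← add_assoc, CharTwo.add_self_eq_zero, zero_add]
        · rw [← (h0 i j).1, ← add_assoc, CharTwo.add_self_eq_zero, zero_add]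
      rw [hN.unique hp, hχx]
  · intro h1
    -- The potential is 1 throughout the component, so the component lies in the cells of its
    -- bounded support.
    obtain ⟨B, hB⟩ := hN.bounded
    refine (Metric.isBounded_iff_subset_closedBall 0).2 ⟨B + 1, fun y hy => ?_⟩
    have h2 := hB _ _ (by rw [H.potential_eq_of_mem_component hN hx hy, h1]; decide)
    rw [mem_closedBall_zero_iff, Prod.norm_def, max_le_iff]
    simp only [Real.norm_eq_abs, abs_le]
    have a := abs_lt.1 h2.1
    have b := abs_lt.1 h2.2
    have a1 : -(B : ℝ) < ⌊y.1⌋ := by exact_mod_cast a.1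
    have a2 : (⌊y.1⌋ : ℝ) < B := by exact_mod_cast a.2
    have b1 : -(B : ℝ) < ⌊y.2⌋ := by exact_mod_cast b.1
    have b2 : (⌊y.2⌋ : ℝ) < B := by exact_mod_cast b.2
    refine ⟨⟨?_, ?_⟩, ?_, ?_⟩ <;>
      linarith [Int.floor_le y.1, Int.lt_floor_add_one y.1, Int.floor_le y.2,
        Int.lt_floor_add_one y.2]

/-- Every point of the curve lies in a closed unit cell where the potential is `0`. -/
theorem exists_cell_potential_eq_zero (hN : IsPotential N h v) {x : Plane} (hx : x ∈ S) :
    ∃ i j : ℤ, i ≤ x.1 ∧ x.1 ≤ i + 1 ∧ j ≤ x.2 ∧ x.2 ≤ j + 1 ∧ N i j = 0 := by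
  obtain ⟨i, j, ⟨h1, h2, h3, h4⟩ | ⟨h1, h2, h3, h4⟩⟩ := (H.mem_iff x).1 hx
  · have := hN.hor i j
    rcases zmod_two_cases (N i j) with h0 | h0
    · exact ⟨i, j, h2, h3, h4.ge, by linarith, h0⟩
    · refine ⟨i, j - 1, h2, h3, by push_cast; linarith, by push_cast; linarith, ?_⟩
      rw [h0, h1] at this
      simpa using this
  · have := hN.ver i j
    rcases zmod_two_cases (N i j) with h0 | h0
    · exact ⟨i, j, h2.ge, by linarith, h3, h4, h0⟩
    · refine ⟨i - 1, j, by push_cast; linarith, by push_cast; linarith, h3, h4, ?_⟩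
      rw [h0, h1] at this
      simpa using this

end GridCurve

/-! ### Cutting a frame -/

/-- The cutter with point set `C` divides the frame `f` into the frames `g₁` and `g₂`. -/
structure IsTheta (C : Set Plane) (f g₁ g₂ : Frame) : Prop where
  inside : ∀ x ∈ C, f.Inside x
  cutter_left : C ⊆ g₁.points
  cutter_right : C ⊆ g₂.points
  left_subset : g₁.points ⊆ f.points ∪ C
  right_subset : g₂.points ⊆ f.points ∪ C
  -- Grid points are left out because the arcs and the cutter meet there. The midpoints of unit
  -- edges remain, and they determine the curves.
  mem_iff : ∀ x, x ∉ Set.range GridPt.toPlane → (x ∈ f.points ↔ ¬ (x ∈ g₁.points ↔ x ∈ g₂.points))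

theorem IsTheta.symm {C : Set Plane} {f g₁ g₂ : Frame} (h : IsTheta C f g₁ g₂) :
    IsTheta C f g₂ g₁ where
  inside := h.inside
  cutter_left := h.cutter_right
  cutter_right := h.cutter_left
  left_subset := h.right_subset
  right_subset := h.left_subset
  mem_iff x hx := by rw [h.mem_iff x hx]; tauto

theorem edgePoints_cycleEdges_append (c : StraightLinePath) (B : List GridPt) :
    edgePoints (cycleEdges (c.verts ++ B)) =
      c.points ∪ edgePoints (pathEdges (c.last :: (B ++ [c.first]))) := by
  have h1 : c.verts = c.first :: c.verts.tail := (List.cons_head_tail c.ne_nil).symm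
  have h2 : c.verts = c.verts.dropLast ++ [c.last] := (List.dropLast_append_getLast c.ne_nil).symm
  have h3 : cycleEdges (c.verts ++ B) = pathEdges (c.verts ++ (B ++ [c.first])) := by
    rw [h1, List.cons_append, cycleEdges_cons]
    simp
  rw [h3, StraightLinePath.points]
  nth_rw 1 [h2]
  rw [List.append_assoc, List.singleton_append, pathEdges_append, ← h2, edgePoints_append]

/-- The frame is a union of two arcs `P` and `Q`, and its parts are the cutter with `P` and the
cutter with `Q`. These three pieces meet pairwise only in grid points. The role of the smallest grid
point is just to name the parts, and the conclusion is symmetric in them. -/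
theorem IsAssoFr.isTheta {f g₁ g₂ : Frame} {c : StraightLinePath} (hc : IsCutter c f)
    (h : IsAssoFr f c g₁ g₂) : IsTheta c.points f g₁ g₂ := by
  obtain ⟨f', A, B, p, ⟨hf', -⟩, hverts, -, h⟩ := h
  have hA := edgePoints_cycleEdges_append c A.reverse
  rw [← edgePoints_pathEdges_reverse (_ :: _)] at hA
  simp only [List.reverse_cons, List.reverse_append, List.reverse_reverse, List.reverse_nil,
    List.nil_append, List.cons_append] at hA
  rw [edgePoints_cycleEdges_append c B, hA] at h
  have hcyc : cycleEdges f'.verts = pathEdges (c.first :: (A ++ [c.last])) ++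
      pathEdges (c.last :: (B ++ [c.first])) := by
    rw [hverts, List.cons_append, cycleEdges_cons]
    have := pathEdges_append (c.first :: A) c.last (B ++ [c.first])
    simpa using this
  have hplane := f'.plane
  have hnodup := f'.nodup
  rw [hcyc, PlaneEdges, List.pairwise_append] at hplane
  have hpts : f.points = edgePoints (pathEdges (c.first :: (A ++ [c.last]))) ∪
      edgePoints (pathEdges (c.last :: (B ++ [c.first]))) := by
    rw [← hf', Frame.points, hcyc, edgePoints_append]
  have hdisj : ∀ x ∉ Set.range GridPt.toPlane,
      x ∈ edgePoints (pathEdges (c.first :: (A ++ [c.last]))) →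
      x ∉ edgePoints (pathEdges (c.last :: (B ++ [c.first]))) := by
    rintro x hx ⟨e, he, hxe⟩ ⟨e', he', hxe'⟩
    rcases (hplane.2.2 e he e' he' x hxe hxe').1 with rfl | rfl <;> exact hx ⟨_, rfl⟩
  have hcut : ∀ x ∉ Set.range GridPt.toPlane, x ∈ c.points → x ∉ f.points := by
    intro x hx hxc hxf
    have : x ∈ f.points ∩ c.points := ⟨hxf, hxc⟩
    rw [hc.2.2] at this
    rcases this with rfl | rfl <;> exact hx ⟨_, rfl⟩
  generalize edgePoints (pathEdges (c.first :: (A ++ [c.last]))) = P at *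
  generalize edgePoints (pathEdges (c.last :: (B ++ [c.first]))) = Q at *
  have main : ∀ g₁ g₂ : Frame, g₁.points = c.points ∪ P → g₂.points = c.points ∪ Q →
      IsTheta c.points f g₁ g₂ := by
    intro g₁ g₂ h1 h2
    refine ⟨hc.2.1, ?_, ?_, ?_, ?_, ?_⟩
    · rw [h1]; exact Set.subset_union_left
    · rw [h2]; exact Set.subset_union_left
    · rw [h1, hpts]; intro x hx; simp only [Set.mem_union] at hx ⊢; tauto
    · rw [h2, hpts]; intro x hx; simp only [Set.mem_union] at hx ⊢; tauto
    · intro x hx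
      have a := hdisj x hx
      have b := hcut x hx
      rw [hpts] at b ⊢
      rw [h1, h2]
      simp only [Set.mem_union] at b ⊢
      tauto
  rcases h with ⟨-, h1, h2⟩ | ⟨-, h1, h2⟩
  · exact (main g₂ g₁ h2.1 h1.1).symm
  · exact main g₁ g₂ h1.1 h2.1

namespace IsTheta

variable {C : Set Plane} {f g₁ g₂ : Frame} (h : IsTheta C f g₁ g₂)

include h

theorem hor_add (i j : ℤ) : f.hor i j = g₁.hor i j + g₂.hor i j := by
  have hx : ((i : ℝ) + 1 / 2, (j : ℝ)) ∉ Set.range GridPt.toPlane := by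
    rintro ⟨⟨a, b⟩, hab⟩
    have h1 : (a : ℝ) = i + 1 / 2 := congrArg Prod.fst hab
    have h2 : ((2 * a : ℤ) : ℝ) = ((2 * i + 1 : ℤ) : ℝ) := by push_cast; linarith
    norm_cast at h2
    omega
  have := h.mem_iff _ hx
  rw [f.gridCurve.hor_mid_mem_iff, g₁.gridCurve.hor_mid_mem_iff,
    g₂.gridCurve.hor_mid_mem_iff] at this
  generalize f.hor i j = a, g₁.hor i j = b, g₂.hor i j = c at *
  revert a b c; decide

theorem ver_add (i j : ℤ) : f.ver i j = g₁.ver i j + g₂.ver i j := by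
  have hx : ((i : ℝ), (j : ℝ) + 1 / 2) ∉ Set.range GridPt.toPlane := by
    rintro ⟨⟨a, b⟩, hab⟩
    have h1 : (b : ℝ) = j + 1 / 2 := congrArg Prod.snd hab
    have h2 : ((2 * b : ℤ) : ℝ) = ((2 * j + 1 : ℤ) : ℝ) := by push_cast; linarith
    norm_cast at h2
    omega
  have := h.mem_iff _ hx
  rw [f.gridCurve.ver_mid_mem_iff, g₁.gridCurve.ver_mid_mem_iff,
    g₂.gridCurve.ver_mid_mem_iff] at this
  generalize f.ver i j = a, g₁.ver i j = b, g₂.ver i j = c at *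
  revert a b c; decide

/-- The frame is the sum of its parts modulo 2, so the sum of their potentials is a potential for
it. -/
theorem exists_potentials : ∃ N N₁ N₂, IsPotential N f.hor f.ver ∧ IsPotential N₁ g₁.hor g₁.ver ∧
    IsPotential N₂ g₂.hor g₂.ver ∧ ∀ i j, N i j = N₁ i j + N₂ i j := by
  obtain ⟨N₁, h1⟩ := g₁.gridCurve.exists_isPotential
  obtain ⟨N₂, h2⟩ := g₂.gridCurve.exists_isPotential
  refine ⟨_, N₁, N₂, ?_, h1, h2, fun _ _ => rfl⟩
  convert h1.add h2 using 1 <;> ext i j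
  · exact h.hor_add i j
  · exact h.ver_add i j

theorem notMem_left {x : Plane} (hf : x ∉ f.points) (hC : x ∉ C) : x ∉ g₁.points := fun hx =>
  (h.left_subset hx).elim hf hC

/-- An unbounded component of the complement of `f` contains no point of the cutter, hence avoids
`g₁`, and would lie in the bounded component of `x` for `g₁`. -/
theorem strictlyInside_of_notMem {x : Plane} (hf : x ∉ f.points) (hx : g₁.StrictlyInside x) :
    f.StrictlyInside x := by
  refine ⟨hf, ?_⟩
  by_contra hb
  have hsub : connectedComponentIn f.pointsᶜ x ⊆ g₁.pointsᶜ := by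
    intro y hy
    refine h.notMem_left (connectedComponentIn_subset _ _ hy) fun hC => ?_
    rcases h.inside y hC with h1 | h1
    · exact connectedComponentIn_subset _ _ hy h1
    · apply hb
      rw [connectedComponentIn_eq hy]
      exact h1.2
  exact hb (hx.2.subset (isPreconnected_connectedComponentIn.subset_connectedComponentIn
    (mem_connectedComponentIn hf) hsub))

theorem strictlyInside_of_left {x : Plane} (hx : g₁.StrictlyInside x) : f.StrictlyInside x := by
  by_cases hf : x ∈ f.points
  -- A point of `f` touches a cell of potential 0. The centre of that cell is in the same component
  -- for `g₁` as `x`, hence strictly inside `f` by the previous case, where the potential must be 1.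
  · exfalso
    obtain ⟨N, hN⟩ := f.gridCurve.exists_isPotential
    obtain ⟨i, j, h1, h2, h3, h4, h0⟩ := f.gridCurve.exists_cell_potential_eq_zero hN hf
    have hc : g₁.StrictlyInside (center i j) := by
      refine ⟨g₁.gridCurve.center_mem_compl i j, ?_⟩
      rw [← g₁.gridCurve.component_center hx.1 h1 h2 h3 h4]
      exact hx.2
    have hc' := h.strictlyInside_of_notMem (f.gridCurve.center_mem_compl i j) hc
    have h5 := (f.gridCurve.isBounded_component_iff hN hc'.1).1 hc'.2
    have e1 : ⌊(center i j).1⌋ = i := by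
      rw [Int.floor_eq_iff, center]; constructor <;> dsimp only <;> linarith
    have e2 : ⌊(center i j).2⌋ = j := by
      rw [Int.floor_eq_iff, center]; constructor <;> dsimp only <;> linarith
    rw [e1, e2, h0] at h5
    exact absurd h5 (by decide)
  · exact h.strictlyInside_of_notMem hf hx

theorem left_or_right {x : Plane} (hx : f.StrictlyInside x) (hC : x ∉ C) :
    g₁.StrictlyInside x ∨ g₂.StrictlyInside x := by
  obtain ⟨N, N₁, N₂, hN, hN₁, hN₂, hadd⟩ := h.exists_potentials
  have h1 := h.notMem_left hx.1 hC
  have h2 := h.symm.notMem_left hx.1 hC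
  have h0 := (f.gridCurve.isBounded_component_iff hN hx.1).1 hx.2
  rw [Frame.StrictlyInside, Frame.StrictlyInside, g₁.gridCurve.isBounded_component_iff hN₁ h1,
    g₂.gridCurve.isBounded_component_iff hN₂ h2]
  rw [hadd] at h0
  rcases zmod_two_cases (N₁ ⌊x.1⌋ ⌊x.2⌋) with h3 | h3
  · rw [h3, zero_add] at h0
    exact .inr ⟨h2, h0⟩
  · exact .inl ⟨h1, h3⟩

theorem not_left_and_right {x : Plane} (h1 : g₁.StrictlyInside x) : ¬ g₂.StrictlyInside x := by
  intro h2
  obtain ⟨N, N₁, N₂, hN, hN₁, hN₂, hadd⟩ := h.exists_potentials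
  have hf := h.strictlyInside_of_left h1
  have h0 := (f.gridCurve.isBounded_component_iff hN hf.1).1 hf.2
  rw [hadd, (g₁.gridCurve.isBounded_component_iff hN₁ h1.1).1 h1.2,
    (g₂.gridCurve.isBounded_component_iff hN₂ h2.1).1 h2.2] at h0
  exact absurd h0 (by decide)

theorem strictlyOutside_right {x : Plane} (h1 : g₁.StrictlyInside x) : g₂.StrictlyOutside x := by
  have hf := h.strictlyInside_of_left h1
  have h2 := h.symm.notMem_left hf.1 fun hC => h1.1 (h.cutter_left hC)
  exact ⟨h2, fun hb => h.not_left_and_right h1 ⟨h2, hb⟩⟩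

theorem strictlyOutside_left {x : Plane} (hx : f.StrictlyOutside x) : g₁.StrictlyOutside x := by
  have h1 : x ∉ g₁.points := h.notMem_left hx.1 fun hC => (h.inside x hC).elim hx.1 fun h => hx.2 h.2
  exact ⟨h1, fun hb => hx.2 (h.strictlyInside_of_left ⟨h1, hb⟩).2⟩

end IsTheta

/-! ### Separated edges have turning points -/

/-- The parameters of common points form a compact set; its least element gives the first contact
seen from `a`. -/
theorem exists_first_point_segment {S : Set Plane} (hS : IsClosed S) {a b : Plane} (ha : a ∉ S)
    (hm : (segment ℝ a b ∩ S).Nonempty) : ∃ p ∈ segment ℝ a b, p ∈ S ∧ p ≠ a ∧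
      ∀ y ∈ segment ℝ p a, y ∈ S → y = p := by
  have hcpt : IsCompact (Set.Icc (0 : ℝ) 1 ∩ (fun t : ℝ => a + t • (b - a)) ⁻¹' S) :=
    isCompact_Icc.inter_right (hS.preimage (by fun_prop))
  rw [segment_eq_image'] at hm ⊢
  obtain ⟨_, ⟨t, ht, rfl⟩, htS⟩ := hm
  obtain ⟨θ, ⟨hθ, hθS⟩, hmin⟩ := hcpt.exists_isLeast ⟨t, ht, htS⟩
  have hpos : 0 < θ := hθ.1.lt_of_ne fun h0 => ha (by simpa [← h0] using hθS)
  refine ⟨_, ⟨θ, hθ, rfl⟩, hθS, fun h => ha (h ▸ hθS), ?_⟩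
  dsimp only
  intro y hy hyS
  rw [segment_symm, segment_eq_image'] at hy
  obtain ⟨σ, ⟨h0, h1⟩, rfl⟩ := hy
  dsimp only at hyS ⊢
  have heq : a + σ • (a + θ • (b - a) - a) = a + (σ * θ) • (b - a) := by
    rw [add_sub_cancel_left, smul_smul]
  rw [heq] at hyS ⊢
  have h2 : θ ≤ σ * θ :=
    hmin ⟨⟨by positivity, (mul_le_of_le_one_left hpos.le h1).trans hθ.2⟩, hyS⟩
  rw [le_antisymm (mul_le_of_le_one_left hpos.le h1) h2]

/-- If the ends of a path lie in different components of the complement of a frame, then some edge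
of the path has a first common point with the frame. -/
theorem exists_first_common_point (P : StraightLinePath) (f : Frame)
    (h0 : P.first.toPlane ∉ f.points)
    (hne : connectedComponentIn f.pointsᶜ P.first.toPlane ≠
      connectedComponentIn f.pointsᶜ P.last.toPlane) :
    ∃ l, ∃ hl : l + 1 < P.verts.length, ∃ p ∈ seg (P.verts[l], P.verts[l + 1]),
      p ∈ f.points ∧ p ≠ P.verts[l].toPlane ∧
      ∀ y ∈ segment ℝ p P.verts[l].toPlane, y ∈ f.points → y = p := by
  classical
  have hlen := P.two_le
  have hfirst : P.first = P.verts[0] := List.head_eq_getElem _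
  have hlast : P.last = P.verts[P.verts.length - 1] := List.getLast_eq_getElem _
  have hex : ∃ l, ∃ hl : l + 1 < P.verts.length,
      (seg (P.verts[l], P.verts[l + 1]) ∩ f.points).Nonempty := by
    by_contra hno
    apply hne
    have key : ∀ l (hl : l < P.verts.length), connectedComponentIn f.pointsᶜ P.first.toPlane =
        connectedComponentIn f.pointsᶜ P.verts[l].toPlane := by
      intro l
      induction l with
      | zero => intro _; rw [hfirst]
      | succ l ih =>
        intro hl
        rw [ih (by omega)]
        apply connectedComponentIn_eq_of_segment
        intro x hx hxf
        exact hno ⟨l, hl, x, hx, hxf⟩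
    rw [hlast]
    exact key _ _
  -- Taking the first edge that meets the frame ensures that its starting vertex is off the frame,
  -- since the preceding edge would otherwise meet it.
  obtain ⟨hl, hmeet⟩ := Nat.find_spec hex
  have hmin := fun m (hm : m < Nat.find hex) => Nat.find_min hex hm
  generalize Nat.find hex = l at *
  have ha : P.verts[l].toPlane ∉ f.points := by
    rcases Nat.eq_zero_or_pos l with rfl | hpos
    · rwa [← hfirst]
    · intro hf
      obtain ⟨m, rfl⟩ : ∃ m, l = m + 1 := ⟨l - 1, by omega⟩
      exact hmin m (by omega) ⟨by omega, _, right_mem_segment _ _ _, hf⟩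
  obtain ⟨p, hp, hpf, hpa, hseg⟩ :=
    exists_first_point_segment f.isCompact_points.isClosed ha hmeet
  exact ⟨l, hl, p, hp, hpf, hpa, hseg⟩

/-- Of the horizontal and the vertical unit segment at `q`, one is not parallel to `ab`. -/
theorem toPlane_mem_enrichedSegment {q : GridPt} {a b : Plane} (hne : a ≠ b)
    (hq : q.toPlane ∈ segment ℝ a b) : q.toPlane ∈ enrichedSegment a b := by
  refine ⟨hq, ?_⟩
  by_cases h : b.1 - a.1 = 0
  · refine ⟨q, (q.1 + 1, q.2), left_mem_segment _ _ _, fun h' => hne ?_⟩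
    push_cast at h'
    ext <;> linarith
  · refine ⟨q, (q.1, q.2 + 1), left_mem_segment _ _ _, ?_⟩
    simpa using h

theorem mem_enrichedSegment_left {a b p : Plane} (hp : p ∈ enrichedSegment a b) (hne : p ≠ a) :
    p ∈ enrichedSegment p a := by
  obtain ⟨hp, g, h, hgh, hcross⟩ := hp
  refine ⟨left_mem_segment _ _ _, g, h, hgh, ?_⟩
  rw [segment_eq_image'] at hp
  obtain ⟨t, -, rfl⟩ := hp
  have ht : t ≠ 0 := by rintro rfl; simp at hne
  have := mul_ne_zero (neg_ne_zero.2 ht) hcross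
  simp only [Prod.fst_add, Prod.snd_add, Prod.smul_fst, Prod.smul_snd, Prod.fst_sub, Prod.snd_sub,
    smul_eq_mul]
  convert this using 1
  ring

/-- If the segment `ab` meets the segment `cd` at `p`, and no other point between `p` and `a` lies
on `cd`, then `p` is an end of `cd` or the segments are not parallel. -/
theorem endpoint_of_parallel {a b c d p : Plane} (hcd : c ≠ d) (hp : p ∈ segment ℝ a b)
    (hpa : p ≠ a) (hp' : p ∈ segment ℝ c d)
    (hseg : ∀ y ∈ segment ℝ p a, y ∈ segment ℝ c d → y = p)
    (hpar : (b.1 - a.1) * (d.2 - c.2) - (b.2 - a.2) * (d.1 - c.1) = 0) : p = c ∨ p = d := by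
  by_contra! hends
  obtain ⟨l, hl⟩ : ∃ l : ℝ, a - p = l • (d - c) := by
    rw [segment_eq_image'] at hp
    obtain ⟨t, -, rfl⟩ := hp
    by_cases h1 : d.1 - c.1 = 0
    · have h2 : d.2 - c.2 ≠ 0 := fun h' => hcd (by ext <;> linarith)
      have h3 : b.1 - a.1 = 0 := by
        rw [h1, mul_zero, sub_zero] at hpar
        exact (mul_eq_zero.1 hpar).resolve_right h2
      refine ⟨-t * (b.2 - a.2) / (d.2 - c.2), ?_⟩
      ext
      · simp [h1, h3]
      · simp; field_simp
    · refine ⟨-t * (b.1 - a.1) / (d.1 - c.1), ?_⟩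
      ext
      · simp; field_simp
      · simp; field_simp; linear_combination t * hpar
  have hl0 : l ≠ 0 := by
    rintro rfl
    rw [zero_smul, sub_eq_zero] at hl
    exact hpa hl.symm
  have hlpos : 0 < |l| := abs_pos.2 hl0
  rw [segment_eq_image'] at hp'
  obtain ⟨s, ⟨h0, h1⟩, hs⟩ := hp'
  dsimp only at hs
  have hs0 : 0 < s := h0.lt_of_ne (by rintro rfl; simp at hs; exact hends.1 hs.symm)
  have hs1 : s < 1 := h1.lt_of_ne (by rintro rfl; simp at hs; exact hends.2 hs.symm)
  -- As `p` is interior to `cd` and `a - p` is parallel to it, a sufficiently short step from `p`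
  -- towards `a` stays on `cd`; this contradicts `hseg`.
  obtain ⟨ε, hε0, hε1, hε⟩ : ∃ ε : ℝ, 0 < ε ∧ ε ≤ 1 ∧ |ε * l| ≤ min s (1 - s) := by
    have hm : 0 < min s (1 - s) := lt_min hs0 (by linarith)
    refine ⟨min 1 (min s (1 - s) / |l|), lt_min one_pos (by positivity), min_le_left _ _, ?_⟩
    rw [abs_mul, abs_of_pos (lt_min one_pos (by positivity)), ← le_div_iff₀ hlpos]
    exact min_le_right _ _
  rw [le_min_iff, abs_le, abs_le] at hε
  have := hseg (p + ε • (a - p)) (by rw [segment_eq_image']; exact ⟨ε, ⟨hε0.le, hε1⟩, rfl⟩) (by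
    rw [segment_eq_image']
    refine ⟨s + ε * l, ⟨by linarith, by linarith⟩, ?_⟩
    dsimp only
    rw [hl, ← hs, smul_smul, add_smul, add_assoc])
  rw [add_eq_left, smul_eq_zero, sub_eq_zero] at this
  exact this.elim hε0.ne' fun h => hpa h.symm

/-- If the two segments through `p` are not parallel, each witnesses that `p` is enriched on the
other. If they are parallel, a first contact is possible only at an end of the frame edge, which is
a grid point. -/
theorem mem_enriched_of_first_common_point {f : Frame} {a b : GridPt} {p : Plane} (hab : a ≠ b)
    (hp : p ∈ seg (a, b)) (hpf : p ∈ f.points) (hpa : p ≠ a.toPlane)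
    (hseg : ∀ y ∈ segment ℝ p a.toPlane, y ∈ f.points → y = p) :
    p ∈ enrichedSegment a.toPlane b.toPlane ∧ p ∈ enriched (cycleEdges f.verts) := by
  obtain ⟨e, he, hpe⟩ := hpf
  have hne : e.1.toPlane ≠ e.2.toPlane := toPlane_injective.ne (f.fst_ne_snd he)
  have hab' : a.toPlane ≠ b.toPlane := toPlane_injective.ne hab
  by_cases hpar : (b.toPlane.1 - a.toPlane.1) * (e.2.toPlane.2 - e.1.toPlane.2) -
      (b.toPlane.2 - a.toPlane.2) * (e.2.toPlane.1 - e.1.toPlane.1) = 0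
  · rcases endpoint_of_parallel hne hp hpa hpe (fun y hy hye => hseg y hy ⟨e, he, hye⟩) hpar
      with rfl | rfl
    · exact ⟨toPlane_mem_enrichedSegment hab' hp, e, he, toPlane_mem_enrichedSegment hne hpe⟩
    · exact ⟨toPlane_mem_enrichedSegment hab' hp, e, he, toPlane_mem_enrichedSegment hne hpe⟩
  · refine ⟨⟨hp, e.1, e.2, hpe, hpar⟩, e, he, hpe, a, b, hp, fun h => hpar ?_⟩
    simp only [GridPt.toPlane] at h ⊢
    linarith

theorem enriched_subset (E : List (GridPt × GridPt)) : enriched E ⊆ edgePoints E :=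
  fun _ ⟨e, he, hx⟩ => ⟨e, he, hx.1⟩

theorem mem_pathEdges_drop_take {L : List GridPt} {i j : ℕ} {e : GridPt × GridPt}
    (hj : j < L.length) : e ∈ pathEdges ((L.take (j + 1)).drop i) ↔
      ∃ k, ∃ h : k < j, i ≤ k ∧ e = (L[k], L[k + 1]) := by
  rw [mem_pathEdges]
  constructor
  · rintro ⟨k, hk, rfl⟩
    simp only [List.length_drop, List.length_take] at hk
    refine ⟨i + k, by omega, by omega, ?_⟩
    simp [add_assoc]
  · rintro ⟨k, hk, hik, rfl⟩
    obtain ⟨m, rfl⟩ := Nat.exists_eq_add_of_le hik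
    refine ⟨m, ?_, ?_⟩
    · simp only [List.length_drop, List.length_take]; omega
    · simp [add_assoc]

/-- The smallest subpath is the edge itself if `p` is interior to it, and two consecutive edges if
`p` is its far end. In both cases it starts at index `l`, the side from which `p` is approached. -/
theorem exists_subpathAround {P : StraightLinePath} {p : Plane} {l : ℕ}
    (hl : l + 1 < P.verts.length) (hp : p ∈ seg (P.verts[l], P.verts[l + 1]))
    (hpl : p ≠ P.verts[l].toPlane) (hlast : p ≠ P.last.toPlane) :
    ∃ j, SubpathAround P p ⟨l, by omega⟩ j ∧
      ∀ i' j', SubpathAround P p i' j' → (j : ℕ) - l ≤ (j' : ℕ) - i' := by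
  by_cases hpb : p = P.verts[l + 1].toPlane
  · have hl2 : l + 2 < P.verts.length := by
      by_contra hlt
      apply hlast
      rw [hpb, StraightLinePath.last, List.getLast_eq_getElem]
      congr 2
      omega
    refine ⟨⟨l + 2, hl2⟩, ⟨?_, hpl, ?_, ?_⟩, ?_⟩
    · simp [Fin.lt_def]
    · rw [hpb]
      refine toPlane_injective.ne fun h => ?_
      have := (P.nodup.getElem_inj_iff).1 h
      omega
    · exact ⟨_, (mem_pathEdges_drop_take hl2).2 ⟨l, by omega, le_rfl, rfl⟩, hp⟩
    · rintro ⟨i, hi⟩ ⟨j, hj⟩ ⟨hij, hpi, hpj, e, he, hpe⟩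
      obtain ⟨k, hkj, hik, rfl⟩ := (mem_pathEdges_drop_take hj).1 he
      simp only [Fin.lt_def, List.get_eq_getElem] at hij hik hpi hpj ⊢
      -- A shorter subpath would be a single edge through the vertex `p`, and planarity makes `p`
      -- one of its ends.
      by_contra hlt
      obtain rfl : k = i := by omega
      obtain rfl : j = k + 1 := by omega
      rw [hpb] at hp hpi hpj hpe
      by_cases hee : (P.verts[l], P.verts[l + 1]) = (P.verts[k], P.verts[k + 1])
      · exact hpj (congrArg (fun e : GridPt × GridPt => e.2.toPlane) hee)
      · rcases (P.plane.endpoints (mem_pathEdges.2 ⟨l, hl, rfl⟩) (mem_pathEdges.2 ⟨k, hj, rfl⟩) hee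
          hp hpe).2 with h | h
        · exact hpi (congrArg _ h)
        · exact hpj (congrArg _ h)
  · refine ⟨⟨l + 1, hl⟩, ⟨?_, hpl, hpb, ?_⟩, ?_⟩
    · simp [Fin.lt_def]
    · exact ⟨_, (mem_pathEdges_drop_take hl).2 ⟨l, by omega, le_rfl, rfl⟩, hp⟩
    · rintro i j ⟨hij, -⟩
      simp only [Fin.lt_def] at hij ⊢
      omega

namespace PolylineGridDrawing

variable {V : Type*} {G : SimpleGraph V} (d : PolylineGridDrawing G)

/-- The first contact `p` works: the segment from `p` back to the preceding vertex meets the frame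
only in `p`, so the whole of it serves as the initial piece and the parameter is `1`. -/
theorem exists_isTurningPoint {f : Frame} {u v : V} (hadj : G.Adj u v) (h : d.Separates f u v) :
    ∃ p, p ∈ enriched (pathEdges (d.edge ⟨s(u, v), hadj⟩).verts) ∩
      enriched (cycleEdges f.verts) ∧ d.IsTurningPoint f ⟨s(u, v), hadj⟩ p := by
  wlog hio : f.StrictlyInside (d.pos u) ∧ f.StrictlyOutside (d.pos v) generalizing u v
  · have h' := h.resolve_left hio
    have := this hadj.symm (.inl h') h'
    have e : (⟨s(v, u), hadj.symm⟩ : G.edgeSet) = ⟨s(u, v), hadj⟩ := Subtype.ext Sym2.eq_swap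
    rwa [e] at this
  obtain ⟨hu, hv⟩ := hio
  have hne : connectedComponentIn f.pointsᶜ (d.pos u) ≠ connectedComponentIn f.pointsᶜ (d.pos v) :=
    fun h => hv.2 (h ▸ hu.2)
  have hends := d.edge_ends ⟨s(u, v), hadj⟩
  generalize he : (⟨s(u, v), hadj⟩ : G.edgeSet) = e at *
  have hev : (e : Sym2 V) = s(u, v) := by rw [← he]
  rw [hev, Sym2.map_mk, Sym2.eq_iff] at hends
  have hfirst : (d.edge e).first.toPlane ∉ f.points := by
    rcases hends with h | h
    · rw [h.1]; exact hu.1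
    · rw [h.1]; exact hv.1
  have hlast : (d.edge e).last.toPlane ∉ f.points := by
    rcases hends with h | h
    · rw [h.2]; exact hv.1
    · rw [h.2]; exact hu.1
  have hcomp : connectedComponentIn f.pointsᶜ (d.edge e).first.toPlane ≠
      connectedComponentIn f.pointsᶜ (d.edge e).last.toPlane := by
    rcases hends with h | h
    · rw [h.1, h.2]; exact hne
    · rw [h.1, h.2]; exact hne.symm
  have hno : ∀ w ∈ (e : Sym2 V), d.pos w ∉ f.points := by
    intro w hw
    rw [hev, Sym2.mem_iff] at hw
    rcases hw with rfl | rfl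
    · exact hu.1
    · exact hv.1
  obtain ⟨l, hl, p, hp, hpf, hpl, hseg⟩ := exists_first_common_point (d.edge e) f hfirst hcomp
  obtain ⟨h1, h2⟩ := mem_enriched_of_first_common_point
    (fun h => by have := ((d.edge e).nodup.getElem_inj_iff).1 h; omega) hp hpf hpl hseg
  have h3 : p ∈ enriched (pathEdges (d.edge e).verts) := ⟨_, mem_pathEdges.2 ⟨l, hl, rfl⟩, h1⟩
  obtain ⟨j, hj, hmin⟩ := exists_subpathAround hl hp hpl fun h => hlast (h ▸ hpf)
  refine ⟨p, ⟨h3, h2⟩, .inr ⟨fun w hw h => hno w hw (h ▸ hpf), ⟨h3, h2⟩, ⟨l, by omega⟩, j, hj, hmin,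
    .inl ⟨1, one_pos, le_rfl, ?_⟩⟩⟩
  rw [AffineMap.lineMap_apply_one]
  refine Set.eq_singleton_iff_unique_mem.2 ⟨⟨mem_enrichedSegment_left h1 hpl, h2⟩, ?_⟩
  rintro y ⟨hy, hy'⟩
  exact hseg y hy.1 (enriched_subset _ hy')

end PolylineGridDrawing

/-! ### The rectangle around a drawing -/

theorem mem_seg_vertical {a b d : ℤ} (h : b ≤ d) {x : Plane} :
    x ∈ seg ((a, b), (a, d)) ↔ x.1 = a ∧ b ≤ x.2 ∧ x.2 ≤ d := by
  simp only [seg, GridPt.toPlane]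
  rw [← Prod.image_mk_segment_right, segment_eq_Icc (by exact_mod_cast h)]
  constructor
  · rintro ⟨y, hy, rfl⟩
    exact ⟨rfl, hy⟩
  · rintro ⟨h1, hy⟩
    exact ⟨x.2, hy, by rw [← h1]⟩

theorem mem_seg_horizontal {a c b : ℤ} (h : a ≤ c) {x : Plane} :
    x ∈ seg ((a, b), (c, b)) ↔ x.2 = b ∧ a ≤ x.1 ∧ x.1 ≤ c := by
  simp only [seg, GridPt.toPlane]
  rw [← Prod.image_mk_segment_left, segment_eq_Icc (by exact_mod_cast h)]
  constructor
  · rintro ⟨y, hy, rfl⟩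
    exact ⟨rfl, hy⟩
  · rintro ⟨h1, hy⟩
    exact ⟨x.1, hy, by rw [← h1]⟩

/-- Off the boundary, the open rectangle and the complement of the closed one are disjoint open sets
covering everything, so a connected set that meets the first stays in it. -/
theorem Frame.strictlyInside_rectangle {f : Frame} {a b c d : ℤ}
    (hf : f.verts = [(a, b), (a, d), (c, d), (c, b)]) {x : Plane} (h1 : a < x.1) (h2 : x.1 < c)
    (h3 : b < x.2) (h4 : x.2 < d) : f.StrictlyInside x := by
  have hac : a ≤ c := by exact_mod_cast (h1.trans h2).le
  have hbd : b ≤ d := by exact_mod_cast (h3.trans h4).le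
  have hpts : ∀ y, y ∈ f.points ↔ (y.1 = a ∧ b ≤ y.2 ∧ y.2 ≤ d) ∨ (y.2 = d ∧ a ≤ y.1 ∧ y.1 ≤ c) ∨
      (y.1 = c ∧ b ≤ y.2 ∧ y.2 ≤ d) ∨ (y.2 = b ∧ a ≤ y.1 ∧ y.1 ≤ c) := by
    intro y
    rw [← mem_seg_vertical hbd, ← mem_seg_vertical hbd, ← mem_seg_horizontal hac,
      ← mem_seg_horizontal hac, seg_swap (c, b), seg_swap (a, b) (c, b)]
    simp [Frame.points, hf, cycleEdges, edgePoints]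
  have hx : x ∉ f.points := by
    rw [hpts]
    rintro (h | h | h | h) <;> linarith [h.1]
  refine ⟨hx, ?_⟩
  have hsub : connectedComponentIn f.pointsᶜ x ⊆
      Set.Ioo (a : ℝ) c ×ˢ Set.Ioo (b : ℝ) d := by
    refine IsPreconnected.subset_left_of_subset_union (v := (Set.Icc (a : ℝ) c ×ˢ
      Set.Icc (b : ℝ) d)ᶜ) (isOpen_Ioo.prod isOpen_Ioo)
      (isClosed_Icc.prod isClosed_Icc).isOpen_compl ?_ ?_
      ⟨x, mem_connectedComponentIn hx, ⟨h1, h2⟩, h3, h4⟩ isPreconnected_connectedComponentIn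
    · rw [Set.disjoint_compl_right_iff_subset]
      exact Set.prod_mono Set.Ioo_subset_Icc_self Set.Ioo_subset_Icc_self
    · intro y hy
      have hy := connectedComponentIn_subset _ _ hy
      by_contra hcon
      rw [Set.mem_union, not_or, Set.mem_compl_iff, not_not] at hcon
      obtain ⟨hno, ⟨ha, hc⟩, hb, hd⟩ := hcon
      refine hy ((hpts y).2 ?_)
      by_contra! hbd
      refine hno ⟨⟨ha.lt_of_ne fun h => ?_, hc.lt_of_ne fun h => ?_⟩,
        hb.lt_of_ne fun h => ?_, hd.lt_of_ne fun h => ?_⟩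
      · linarith [hbd.1 h.symm hb]
      · linarith [hbd.2.2.1 h hb]
      · linarith [hbd.2.2.2 h.symm ha]
      · linarith [hbd.2.1 h ha]
  exact ((Metric.isBounded_Ioo _ _).prod (Metric.isBounded_Ioo _ _)).subset hsub

namespace PolylineGridDrawing

variable {V : Type*} {G : SimpleGraph V} (d : PolylineGridDrawing G)

theorem strictlyInside_of_rectangularVerts [Finite V] {f : Frame} (hf : f.verts = d.rectangularVerts)
    (u : V) : f.StrictlyInside (d.pos u) := by
  have h1 := ciInf_le (Set.finite_range fun u => (d.vert u).1).bddBelow u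
  have h2 := ciInf_le (Set.finite_range fun u => (d.vert u).2).bddBelow u
  have h3 := le_ciSup (Set.finite_range fun u => (d.vert u).1).bddAbove u
  have h4 := le_ciSup (Set.finite_range fun u => (d.vert u).2).bddAbove u
  apply Frame.strictlyInside_rectangle hf <;> simp only [pos, GridPt.toPlane, Int.cast_lt] <;> omega

/-! ### Bags and costs -/

/-- The edges separated by a frame are at most as many as its turning points. -/
theorem encard_separated_le (f : Frame) :
    {e : G.edgeSet | ∃ u v, G.Adj u v ∧ (e : Sym2 V) = s(u, v) ∧ d.Separates f u v}.encard ≤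
      d.turnPoints f := by
  refine le_trans (Set.encard_le_encard ?_) (Set.encard_image_le Prod.snd _)
  rintro ⟨e, he⟩ ⟨u, v, hadj, rfl, hsep⟩
  obtain ⟨p, hp, ht⟩ := d.exists_isTurningPoint hadj hsep
  exact ⟨⟨p, _⟩, ⟨hp, ht⟩, rfl⟩

theorem encard_separated_ends_le (f : Frame) :
    {u | ∃ v, G.Adj u v ∧ d.Separates f u v}.encard ≤ d.turnPoints f + d.turnPoints f := by
  let E := {e : G.edgeSet | ∃ u v, G.Adj u v ∧ (e : Sym2 V) = s(u, v) ∧ d.Separates f u v}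
  -- The two maps pick the ends of an edge in some order, so each separated edge accounts for at
  -- most two vertices.
  let π₁ : G.edgeSet → V := fun e => (Quot.out (e : Sym2 V)).1
  let π₂ : G.edgeSet → V := fun e => (Quot.out (e : Sym2 V)).2
  have hsub : {u | ∃ v, G.Adj u v ∧ d.Separates f u v} ⊆ π₁ '' E ∪ π₂ '' E := by
    rintro u ⟨v, hadj, hsep⟩
    have hE : (⟨s(u, v), hadj⟩ : G.edgeSet) ∈ E := ⟨u, v, hadj, rfl, hsep⟩
    have hout : s((Quot.out s(u, v)).1, (Quot.out s(u, v)).2) = s(u, v) := Quot.out_eq _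
    have hu : u ∈ s((Quot.out s(u, v)).1, (Quot.out s(u, v)).2) := by
      rw [hout]
      exact Sym2.mem_mk_left u v
    rcases Sym2.mem_iff.1 hu with h | h
    · exact .inl ⟨_, hE, h.symm⟩
    · exact .inr ⟨_, hE, h.symm⟩
  have hE := d.encard_separated_le f
  calc _ ≤ (π₁ '' E ∪ π₂ '' E).encard := Set.encard_le_encard hsub
    _ ≤ (π₁ '' E).encard + (π₂ '' E).encard := Set.encard_union_le _ _
    _ ≤ _ := add_le_add ((Set.encard_image_le _ _).trans hE) ((Set.encard_image_le _ _).trans hE)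

theorem encard_verAsso_le (f : Frame) : (d.verAsso f).encard ≤ 2 * d.cost f := by
  refine (Set.encard_union_le _ _).trans ?_
  refine (add_le_add le_rfl (d.encard_separated_ends_le f)).trans ?_
  rw [two_mul, cost, ← add_assoc]
  exact add_le_add (add_le_add le_add_self le_rfl) le_add_self

/-- The cutter is part of both child frames, so vertices drawn on it are drawn on those frames too.
-/
theorem verAssoCutter_subset {C : StraightLinePath} {f g₁ g₂ : Frame}
    (h : IsTheta C.points f g₁ g₂) :
    d.verAssoCutter C f g₁ g₂ ⊆ d.verAsso g₁ ∪ d.verAsso g₂ := by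
  rintro u (hu | ⟨v, hadj, -, -, hsep | hsep⟩)
  · exact .inl (.inl (h.cutter_left hu))
  · exact .inl (.inr ⟨v, hadj, hsep⟩)
  · exact .inr (.inr ⟨v, hadj, hsep⟩)

end PolylineGridDrawing

/-! ### Frame-trees -/

theorem AreChildren.symm {N : Type*} {T : SimpleGraph N} {r v v₁ v₂ : N}
    (h : AreChildren T r v v₁ v₂) : AreChildren T r v v₂ v₁ :=
  ⟨h.1.symm, h.2.trans (Set.pair_comm _ _)⟩

theorem AreChildren.left_mem {N : Type*} {T : SimpleGraph N} {r v v₁ v₂ : N}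
    (h : AreChildren T r v v₁ v₂) : v₁ ∈ childSet T r v := by
  rw [h.2]; exact .inl rfl

/-- The parent is the second node of a shortest walk to the root. -/
theorem exists_mem_childSet {N : Type*} {T : SimpleGraph N} (hT : T.Connected) {r x : N}
    (hx : x ≠ r) : ∃ y, x ∈ childSet T r y := by
  obtain ⟨p, hp⟩ := hT.exists_walk_length_eq_dist x r
  cases p with
  | nil => exact absurd rfl hx
  | @cons _ y _ hadj q =>
    refine ⟨y, hadj.symm, ?_⟩
    rw [SimpleGraph.Walk.length_cons, SimpleGraph.dist_comm] at hp
    have h1 := SimpleGraph.dist_le q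
    rw [SimpleGraph.dist_comm] at h1
    have h2 := hT.dist_triangle (u := r) (v := y) (w := x)
    rw [SimpleGraph.dist_eq_one_iff_adj.2 hadj.symm] at h2
    omega

namespace FrameTree

variable {V N : Type*} {G : SimpleGraph V} {d : PolylineGridDrawing G} {t : FrameTree d N}

/-- Children come as an unordered pair, so they may be listed in the opposite order to the
associated frames; the symmetry of `IsTheta` absorbs this. -/
theorem isTheta {x y z : N} (h : AreChildren t.tree t.root x y z) :
    IsTheta (t.cutter x).points (t.frame x) (t.frame y) (t.frame z) := by
  obtain ⟨hc, v₁, v₂, h', ha⟩ := t.internal x (Set.nonempty_iff_ne_empty.1 ⟨_, h.left_mem⟩)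
  have := ha.isTheta hc
  rcases Set.pair_eq_pair_iff.1 (h.2.symm.trans h'.2) with ⟨rfl, rfl⟩ | ⟨rfl, rfl⟩
  · exact this
  · exact this.symm

theorem exists_sibling {x y : N} (h : y ∈ childSet t.tree t.root x) :
    ∃ z, AreChildren t.tree t.root x y z := by
  obtain ⟨-, v₁, v₂, h', -⟩ := t.internal x (Set.nonempty_iff_ne_empty.1 ⟨_, h⟩)
  rw [h'.2] at h
  rcases h with rfl | rfl
  · exact ⟨_, h'⟩
  · exact ⟨_, h'.symm⟩

theorem exists_children {x : N} {u : V} (h : (t.frame x).StrictlyInside (d.pos u)) :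
    ∃ y z, AreChildren t.tree t.root x y z := by
  have : childSet t.tree t.root x ≠ ∅ := fun h0 => (t.leaf_iff x).1 h0 ⟨_, h⟩
  obtain ⟨-, v₁, v₂, h', -⟩ := t.internal x this
  exact ⟨_, _, h'⟩

/-- A vertex drawn strictly inside a frame but not on its cutter is drawn strictly inside the frame
of a child. -/
theorem exists_child {x : N} {u : V} (h : (t.frame x).StrictlyInside (d.pos u))
    (hu : d.pos u ∉ (t.cutter x).points) : ∃ y z, AreChildren t.tree t.root x y z ∧
      (t.frame y).StrictlyInside (d.pos u) := by
  obtain ⟨y, z, hyz⟩ := exists_children h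
  rcases (isTheta hyz).left_or_right h hu with h | h
  · exact ⟨y, z, hyz, h⟩
  · exact ⟨z, y, hyz.symm, h⟩

theorem mem_bag_of_mem_frame {x : N} {u : V} (h : d.pos u ∈ (t.frame x).points) : u ∈ t.bag x :=
  .inl (.inl h)

theorem mem_bag_of_separates {x : N} {u v : V} (hadj : G.Adj u v)
    (h : d.Separates (t.frame x) u v) : u ∈ t.bag x :=
  .inl (.inr ⟨v, hadj, h⟩)

theorem mem_bag_of_mem_cutter {x y z : N} {u : V} (h : AreChildren t.tree t.root x y z)
    (hu : d.pos u ∈ (t.cutter x).points) : u ∈ t.bag x :=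
  .inr ⟨y, z, h, .inl hu⟩

theorem mem_bag_of_child_separates {x y z : N} {u v : V} (h : AreChildren t.tree t.root x y z)
    (hadj : G.Adj u v) (hu : (t.frame x).Inside (d.pos u)) (hv : (t.frame x).Inside (d.pos v))
    (hsep : d.Separates (t.frame y) u v) : u ∈ t.bag x :=
  .inr ⟨y, z, h, .inr ⟨v, hadj, hu, hv, .inl hsep⟩⟩

theorem _root_.DrawnTW.Frame.inside_or_strictlyOutside (f : Frame) (x : Plane) :
    f.Inside x ∨ f.StrictlyOutside x := by
  simp only [Frame.Inside, Frame.StrictlyInside, Frame.StrictlyOutside]; tauto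

theorem _root_.DrawnTW.PolylineGridDrawing.Separates.symm {f : Frame} {u v : V}
    (h : d.Separates f u v) : d.Separates f v u := Or.symm h

theorem strictlyInside_root [Finite V] (u : V) : (t.frame t.root).StrictlyInside (d.pos u) :=
  d.strictlyInside_of_rectangularVerts t.frame_root u

/-- Induction from the leaves of a frame-tree to its root. -/
theorem child_induction [Finite N] {Q : N → Prop}
    (h : ∀ x, (∀ y ∈ childSet t.tree t.root x, Q y) → Q x) (x : N) : Q x := by
  obtain ⟨M, hM⟩ := (Set.finite_range (t.tree.dist t.root)).bddAbove
  have hM : ∀ x, t.tree.dist t.root x ≤ M := fun x => hM ⟨x, rfl⟩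
  induction hn : M - t.tree.dist t.root x using Nat.strong_induction_on generalizing x with
  | _ n ih =>
    refine h x fun y hy => ih _ ?_ y rfl
    have := hM y
    have := hy.2
    omega

/-- Induction from the root of a frame-tree to its leaves. -/
theorem parent_induction {Q : N → Prop} (root : Q t.root)
    (h : ∀ x y, y ∈ childSet t.tree t.root x → Q x → Q y) (x : N) : Q x := by
  induction hn : t.tree.dist t.root x generalizing x with
  | zero => rwa [← (t.isTree.connected.dist_eq_zero_iff).1 hn]
  | succ n ih =>
    obtain ⟨y, hy⟩ := exists_mem_childSet t.isTree.connected (r := t.root) (x := x) (by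
      rintro rfl; simp at hn)
    exact h y x hy (ih y (by have := hy.2; omega))

/-- The node at which the vertex `u` is cut: it is drawn strictly inside the frame of the node and
on its cutter. -/
def IsHome (t : FrameTree d N) (u : V) (x : N) : Prop :=
  (t.frame x).StrictlyInside (d.pos u) ∧ d.pos u ∈ (t.cutter x).points

theorem IsHome.mem_bag {u : V} {x : N} (h : t.IsHome u x) : u ∈ t.bag x := by
  obtain ⟨y, z, hyz⟩ := exists_children h.1
  exact mem_bag_of_mem_cutter hyz h.2

/-- Starting at the root, `u` stays strictly inside one child frame as long as it is not cut. The
descent cannot end at a leaf, which has no grid point strictly inside. -/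
theorem exists_isHome [Finite V] [Finite N] (t : FrameTree d N) (u : V) : ∃ x, t.IsHome u x := by
  have key : ∀ x, (t.frame x).StrictlyInside (d.pos u) → ∃ x, t.IsHome u x := by
    refine child_induction (t := t) fun x ih hx => ?_
    by_cases hu : d.pos u ∈ (t.cutter x).points
    · exact ⟨x, hx, hu⟩
    · obtain ⟨y, z, hyz, hy⟩ := exists_child hx hu
      exact ih y hyz.left_mem hy
  exact key _ (strictlyInside_root u)

theorem strictlyInside_of_child {x y : N} {u : V} (h : y ∈ childSet t.tree t.root x)
    (hu : (t.frame y).StrictlyInside (d.pos u)) : (t.frame x).StrictlyInside (d.pos u) := by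
  obtain ⟨z, hz⟩ := exists_sibling h
  exact (isTheta hz).strictlyInside_of_left hu

/-- Frames at the same depth have disjoint strict interiors: strict interiors grow towards the root,
so by induction the parents agree, and siblings are disjoint. -/
theorem eq_of_dist_eq {x x' : N} {u : V} (h : (t.frame x).StrictlyInside (d.pos u))
    (h' : (t.frame x').StrictlyInside (d.pos u))
    (hd : t.tree.dist t.root x = t.tree.dist t.root x') : x = x' := by
  induction hn : t.tree.dist t.root x generalizing x x' with
  | zero =>
    rw [← (t.isTree.connected.dist_eq_zero_iff).1 hn,
      (t.isTree.connected.dist_eq_zero_iff).1 (hd.symm.trans hn)]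
  | succ n ih =>
    have hne : ∀ x, t.tree.dist t.root x = n + 1 → x ≠ t.root := by
      rintro x hx rfl
      simp at hx
    obtain ⟨y, hy⟩ := exists_mem_childSet t.isTree.connected (hne x hn)
    obtain ⟨y', hy'⟩ := exists_mem_childSet t.isTree.connected (hne x' (hd ▸ hn))
    have h1 := hy.2
    have h2 := hy'.2
    obtain rfl := ih (strictlyInside_of_child hy h) (strictlyInside_of_child hy' h') (by omega)
      (by omega)
    obtain ⟨z, hz⟩ := exists_sibling hy
    rw [hz.2] at hy'
    rcases hy' with rfl | rfl
    · rfl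
    · exact absurd h' ((isTheta hz).not_left_and_right h)

theorem exists_ancestor {x : N} {u : V} (h : (t.frame x).StrictlyInside (d.pos u)) {k : ℕ}
    (hk : k ≤ t.tree.dist t.root x) :
    ∃ y, (t.frame y).StrictlyInside (d.pos u) ∧ t.tree.dist t.root y = k := by
  induction x using parent_induction (t := t) with
  | root =>
    exact ⟨_, h, by simpa [eq_comm] using hk⟩
  | h x y hxy ih =>
    rcases hk.eq_or_lt with rfl | hlt
    · exact ⟨y, h, rfl⟩
    · exact ih (strictlyInside_of_child hxy h) (by have := hxy.2; omega)

/-- A deeper home would have an ancestor among the children of `x` with `u` strictly inside, but `u`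
lies on the frames of these children because it lies on the cutter of `x`. -/
theorem IsHome.not_dist_lt {x x' : N} {u : V} (h : t.IsHome u x) (h' : t.IsHome u x') :
    ¬ t.tree.dist t.root x < t.tree.dist t.root x' := by
  intro hlt
  obtain ⟨z, hz, hzd⟩ := exists_ancestor h'.1 hlt
  obtain ⟨y, hy⟩ := exists_mem_childSet t.isTree.connected (r := t.root) (x := z) (by
    rintro rfl; simp at hzd)
  have := hy.2
  obtain rfl := eq_of_dist_eq (strictlyInside_of_child hy hz) h.1 (by omega)
  obtain ⟨z', hz'⟩ := exists_sibling hy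
  exact hz.1 ((isTheta hz').cutter_left h.2)

theorem IsHome.unique {x x' : N} {u : V} (h : t.IsHome u x) (h' : t.IsHome u x') : x = x' :=
  eq_of_dist_eq h.1 h'.1 (le_antisymm (not_lt.1 (h'.not_dist_lt h)) (not_lt.1 (h.not_dist_lt h')))

/-- `x` and a home of `u` are connected in the set of nodes whose bags contain `u`. -/
def Reaches (t : FrameTree d N) (u : V) (x : N) : Prop :=
  ∃ (hx : u ∈ t.bag x) (y : N) (hy : t.IsHome u y),
    (t.tree.induce {x | u ∈ t.bag x}).Reachable ⟨x, hx⟩ ⟨y, hy.mem_bag⟩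

theorem Reaches.of_adj {x y : N} {u : V} (h : t.Reaches u y) (hx : u ∈ t.bag x)
    (hadj : t.tree.Adj x y) : t.Reaches u x := by
  obtain ⟨hy, z, hz, hr⟩ := h
  refine ⟨hx, z, hz, (SimpleGraph.Adj.reachable ?_).trans hr⟩
  simpa using hadj

theorem IsHome.reaches {u : V} {x : N} (h : t.IsHome u x) : t.Reaches u x :=
  ⟨h.mem_bag, x, h, .refl _⟩

/-- On the way down to the home of `u`, the vertex `v` remains strictly outside, so the edge stays
separated and `u` stays in every bag. -/
theorem reaches_of_strictlyOutside [Finite N] {u v : V} (hadj : G.Adj u v) (x : N) :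
    (t.frame x).StrictlyInside (d.pos u) → (t.frame x).StrictlyOutside (d.pos v) →
      t.Reaches u x := by
  induction x using child_induction (t := t) with | h x ih => ?_
  intro hu hv
  by_cases hC : d.pos u ∈ (t.cutter x).points
  · exact IsHome.reaches ⟨hu, hC⟩
  · obtain ⟨y, z, hyz, hy⟩ := exists_child hu hC
    exact (ih y hyz.left_mem hy ((isTheta hyz).strictlyOutside_left hv)).of_adj
      (mem_bag_of_separates hadj (.inl ⟨hu, hv⟩)) hyz.left_mem.1

/-- If `u`, `v` are drawn inside a frame and one of its two parts separates them, then the part with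
`u` strictly inside has `v` strictly outside. -/
theorem strictlyOutside_of_separates {x y z : N} {u v : V} (h : AreChildren t.tree t.root x y z)
    (hu : (t.frame y).StrictlyInside (d.pos u))
    (hsep : d.Separates (t.frame y) u v ∨ d.Separates (t.frame z) u v) :
    (t.frame y).StrictlyOutside (d.pos v) := by
  rcases hsep with (⟨-, hv⟩ | ⟨-, hu'⟩) | (⟨hu', -⟩ | ⟨hv, -⟩)
  · exact hv
  · exact absurd hu.2 hu'.2
  · exact absurd hu' ((isTheta h).not_left_and_right hu)
  · exact (isTheta h).symm.strictlyOutside_right hv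

/-- At the parent, `v` is either inside the frame, and the edge enters the bag through the cutter,
or strictly outside, and the frame of the parent separates the edge. -/
theorem exists_parent_strictlyInside [Finite V] {x : N} {u v : V}
    (hu : (t.frame x).StrictlyInside (d.pos u)) (hv : (t.frame x).StrictlyOutside (d.pos v))
    (hadj : G.Adj u v) : ∃ y, x ∈ childSet t.tree t.root y ∧ u ∈ t.bag y ∧ v ∈ t.bag y := by
  obtain ⟨y, hy⟩ := exists_mem_childSet t.isTree.connected (r := t.root) (x := x) (by
    rintro rfl
    exact hv.2 (strictlyInside_root v).2)
  obtain ⟨z, hz⟩ := exists_sibling hy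
  have hu' := strictlyInside_of_child hy hu
  refine ⟨y, hy, ?_⟩
  rcases (t.frame y).inside_or_strictlyOutside (d.pos v) with h | h
  · exact ⟨mem_bag_of_child_separates hz hadj (.inr hu') h (.inl ⟨hu, hv⟩),
      mem_bag_of_child_separates hz hadj.symm h (.inr hu') (.inr ⟨hu, hv⟩)⟩
  · exact ⟨mem_bag_of_separates hadj (.inl ⟨hu', h⟩),
      mem_bag_of_separates hadj.symm (.inr ⟨hu', h⟩)⟩

/-- If `u` is in the bag because of the frame, it is also in the bag of the parent, and induction on
the depth applies. Otherwise `u` is strictly inside the frame: it is cut here, or a child frame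
separates one of its edges, and the descent towards `u` reaches the home. -/
theorem reaches_of_mem_bag [Finite V] [Finite N] {u : V} (x : N) (hx : u ∈ t.bag x) :
    t.Reaches u x := by
  induction hn : t.tree.dist t.root x using Nat.strong_induction_on generalizing x with
  | _ n ih =>
    have up : ∀ y, x ∈ childSet t.tree t.root y → u ∈ t.bag y → t.Reaches u x := fun y hy huy =>
      (ih _ (by have := hy.2; omega) y huy rfl).of_adj hx hy.1.symm
    by_cases hf : d.pos u ∈ (t.frame x).points
    · obtain ⟨y, hy⟩ := exists_mem_childSet t.isTree.connected (r := t.root) (x := x) (by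
        rintro rfl
        exact (strictlyInside_root u).1 hf)
      obtain ⟨z, hz⟩ := exists_sibling hy
      refine up y hy ?_
      rcases (isTheta hz).left_subset hf with h | h
      · exact mem_bag_of_mem_frame h
      · exact mem_bag_of_mem_cutter hz h
    · have hx' := hx
      rcases hx' with (h | ⟨v, hadj, ⟨h, h'⟩ | ⟨h, h'⟩⟩) | ⟨y, z, hyz, h | ⟨v, hadj, hu, hv, hsep⟩⟩
      · exact absurd h hf
      · obtain ⟨y, hy, huy, -⟩ := exists_parent_strictlyInside h h' hadj
        exact up y hy huy
      · obtain ⟨y, hy, -, huy⟩ := exists_parent_strictlyInside h h' hadj.symm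
        exact up y hy huy
      · exact IsHome.reaches ⟨((isTheta hyz).inside _ h).resolve_left hf, h⟩
      · have hu := hu.resolve_left hf
        by_cases hC : d.pos u ∈ (t.cutter x).points
        · exact IsHome.reaches ⟨hu, hC⟩
        · have key : ∀ y z, AreChildren t.tree t.root x y z →
              (d.Separates (t.frame y) u v ∨ d.Separates (t.frame z) u v) →
              (t.frame y).StrictlyInside (d.pos u) → t.Reaches u x := fun y z hyz hsep hy =>
            (reaches_of_strictlyOutside hadj y hy (strictlyOutside_of_separates hyz hy hsep)).of_adj
              hx hyz.left_mem.1
          rcases (isTheta hyz).left_or_right hu hC with h | h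
          · exact key y z hyz hsep h
          · exact key z y hyz.symm hsep.symm h

theorem connected_induce [Finite V] [Finite N] (t : FrameTree d N) (u : V) :
    (t.tree.induce {x | u ∈ t.bag x}).Connected := by
  rw [SimpleGraph.connected_iff_exists_forall_reachable]
  obtain ⟨x, hx⟩ := t.exists_isHome u
  refine ⟨⟨x, hx.mem_bag⟩, fun ⟨y, hy⟩ => ?_⟩
  obtain ⟨_, z, hz, h⟩ := reaches_of_mem_bag y hy
  obtain rfl := hx.unique hz
  exact h.symm

/-- Descend towards `v`. Since `u` is never strictly inside a child frame, it stays on the frame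
until `v` is cut, or it becomes strictly outside and the edge is separated. -/
theorem exists_bag_of_mem_frame [Finite N] {u v : V} (hadj : G.Adj u v) (x : N) :
    d.pos u ∈ (t.frame x).points → (t.frame x).StrictlyInside (d.pos v) →
      ∃ y, u ∈ t.bag y ∧ v ∈ t.bag y := by
  induction x using child_induction (t := t) with | h x ih => ?_
  intro hu hv
  by_cases hC : d.pos v ∈ (t.cutter x).points
  · exact ⟨x, mem_bag_of_mem_frame hu, IsHome.mem_bag ⟨hv, hC⟩⟩
  · obtain ⟨y, z, hyz, hy⟩ := exists_child hv hC
    rcases (t.frame y).inside_or_strictlyOutside (d.pos u) with (h | h) | h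
    · exact ih y hyz.left_mem h hy
    · exact absurd hu ((isTheta hyz).strictlyInside_of_left h).1
    · exact ⟨y, mem_bag_of_separates hadj (.inr ⟨hy, h⟩),
        mem_bag_of_separates hadj.symm (.inl ⟨hy, h⟩)⟩

theorem exists_bag [Finite V] [Finite N] (t : FrameTree d N) {u v : V} (hadj : G.Adj u v) :
    ∃ x, u ∈ t.bag x ∧ v ∈ t.bag x := by
  have key : ∀ x, (t.frame x).StrictlyInside (d.pos u) → (t.frame x).StrictlyInside (d.pos v) →
      ∃ x, u ∈ t.bag x ∧ v ∈ t.bag x := by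
    refine child_induction (t := t) fun x ih hu hv => ?_
    by_cases hC : d.pos v ∈ (t.cutter x).points
    · by_cases hC' : d.pos u ∈ (t.cutter x).points
      · exact ⟨x, IsHome.mem_bag ⟨hu, hC'⟩, IsHome.mem_bag ⟨hv, hC⟩⟩
      · obtain ⟨y, z, hyz, hy⟩ := exists_child hu hC'
        -- Here `v` is cut first, so it lies on the child frame that has `u` strictly inside.
        obtain ⟨w, h⟩ := exists_bag_of_mem_frame hadj.symm y ((isTheta hyz).cutter_left hC) hy
        exact ⟨w, h.symm⟩
    · obtain ⟨y, z, hyz, hy⟩ := exists_child hv hC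
      rcases (t.frame y).inside_or_strictlyOutside (d.pos u) with (h | h) | h
      · exact exists_bag_of_mem_frame hadj y h hy
      · exact ih y hyz.left_mem h hy
      · exact ⟨y, mem_bag_of_separates hadj (.inr ⟨hy, h⟩),
          mem_bag_of_separates hadj.symm (.inl ⟨hy, h⟩)⟩
  exact key _ (strictlyInside_root u) (strictlyInside_root v)

theorem isTreeDecomposition [Finite V] [Finite N] (t : FrameTree d N) :
    IsTreeDecomposition G t.tree t.bag :=
  ⟨t.isTree, t.connected_induce, fun _ _ => t.exists_bag⟩

/-! ### Sizes of bags and the width bound -/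

theorem encard_bag_le {v v₁ v₂ : N} (h : AreChildren t.tree t.root v v₁ v₂) :
    (t.bag v).encard ≤
      2 * (d.cost (t.frame v) + d.cost (t.frame v₁) + d.cost (t.frame v₂)) := by
  have hsub : t.bag v ⊆ (d.verAsso (t.frame v) ∪ d.verAsso (t.frame v₁)) ∪
      d.verAsso (t.frame v₂) := by
    rintro u (hu | ⟨w₁, w₂, hw, hu⟩)
    · exact .inl (.inl hu)
    · rcases Set.pair_eq_pair_iff.1 (h.2.symm.trans hw.2) with ⟨rfl, rfl⟩ | ⟨rfl, rfl⟩
      · rcases d.verAssoCutter_subset (isTheta hw) hu with h | h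
        · exact .inl (.inr h)
        · exact .inr h
      · rcases d.verAssoCutter_subset (isTheta hw) hu with h | h
        · exact .inr h
        · exact .inl (.inr h)
  rw [mul_add, mul_add]
  refine (Set.encard_le_encard hsub).trans ((Set.encard_union_le _ _).trans (add_le_add
    ((Set.encard_union_le _ _).trans (add_le_add ?_ ?_)) ?_)) <;> exact d.encard_verAsso_le _

theorem encard_bag_le_of_isLeaf {v : N} (h : t.IsLeaf v) :
    (t.bag v).encard ≤ 2 * d.cost (t.frame v) := by
  refine (Set.encard_le_encard ?_).trans (d.encard_verAsso_le _)
  rintro u (hu | ⟨w₁, w₂, hw, -⟩)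
  · exact hu
  · have := hw.left_mem
    rw [show childSet t.tree t.root v = ∅ from h] at this
    exact absurd this (Set.notMem_empty _)

theorem bagWidth_le (t : FrameTree d N) : bagWidth t.bag ≤ 6 * t.width := by
  -- The bound holds for the largest bag size itself, so the `- 1` is dropped.
  refine tsub_le_self.trans (iSup_le fun v => ?_)
  have hw : ∀ v, d.cost (t.frame v) ≤ t.width := le_iSup fun v => d.cost (t.frame v)
  by_cases hv : t.IsLeaf v
  · exact (encard_bag_le_of_isLeaf hv).trans (mul_le_mul' (by norm_num) (hw v))
  · obtain ⟨-, v₁, v₂, h, -⟩ := t.internal v hv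
    refine (encard_bag_le h).trans ?_
    calc _ ≤ 2 * (t.width + t.width + t.width) :=
          mul_le_mul' le_rfl (add_le_add (add_le_add (hw _) (hw _)) (hw _))
      _ = 6 * t.width := by ring

end FrameTree

theorem treewidth_le {V : Type*} {G : SimpleGraph V} (d : PolylineGridDrawing G) :
    treewidth G ≤ 6 * drawnTreewidth d := by
  rw [drawnTreewidth, ENat.mul_iInf_of_ne (by norm_num)]
  refine le_iInf fun m => ?_
  rw [ENat.mul_iInf_of_ne (by norm_num)]
  refine le_iInf fun D => ?_
  have h : bagWidth D.β ≤ 6 * D.toFrameTree.width := by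
    rw [show D.β = D.toFrameTree.bag from funext D.β_eq]
    exact D.toFrameTree.bagWidth_le
  refine le_trans ?_ h
  refine iInf_le_of_le m ?_
  refine iInf_le_of_le D.tree ?_
  refine iInf_le_of_le D.β ?_
  exact iInf_le_of_le D.isTreeDecomposition le_rfl

end DrawnTW

theorem mainTheorem2 {V : Type*} [Finite V] [Nonempty V] (G : SimpleGraph V)
    (d : DrawnTW.PolylineGridDrawing G) :
    (∀ (N : Type*) [Finite N] (t : DrawnTW.FrameTree d N),
      DrawnTW.IsTreeDecomposition G t.tree t.bag ∧
      (∀ v v₁ v₂, DrawnTW.AreChildren t.tree t.root v v₁ v₂ →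
        (t.bag v).encard ≤
          2 * (d.cost (t.frame v) + d.cost (t.frame v₁) + d.cost (t.frame v₂))) ∧
      (∀ v, t.IsLeaf v → (t.bag v).encard ≤ 2 * d.cost (t.frame v)) ∧
      DrawnTW.bagWidth t.bag ≤ 6 * t.width) ∧
    DrawnTW.treewidth G ≤ 6 * DrawnTW.drawnTreewidth d :=
  ⟨fun _ _ t => ⟨t.isTreeDecomposition, fun _ _ _ => DrawnTW.FrameTree.encard_bag_le,
    fun _ => DrawnTW.FrameTree.encard_bag_le_of_isLeaf, t.bagWidth_le⟩, DrawnTW.treewidth_le d⟩
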